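/- Let $\lambda>0$ and $c=\pi/\sqrt2$. For $L>0$ and impurity positions $y_1,\dots,y_{n-1}\in\Lambda_L=[-L/2,L/2]$, let $-L/2=x_0\le x_1\le\dots\le x_{n-1}\le x_n=L/2$, where $x_1,\dots,x_{n-1}$ is the increasing rearrangement of the $y_k$, let $I_j=(x_{j-1},x_j)$, and let the finite-volume Luttinger–Sy Hamiltonian be the operator $h=\bigoplus_{j=1}^{n}h_D(I_j)$ in $\bigoplus_{j=1}^n L^2(I_j)$, where $h_D(I_j)f=-\tfrac12 f''$ on the domain $\{f\in W^{2}_2(I_j): f(x_{j-1})=f(x_j)=0\}$. Its integrated density of states is $$\mathcal N_L(E)=\frac1L\,\#\{\text{eigenvalues of } h \text{ strictly below } E,\ \text{counted with multiplicity}\}.$$ Let the impurity positions be random variables on a probability space $(\Omega,\mathcal F,\mathbb P)$, and write $\mathcal N_L^\omega(E)$ for the resulting random variable. Put $$\mathcal N_\lambda(E)=\lambda\,\frac{e^{-c\lambda/\sqrt E}}{1-e^{-c\lambda/\sqrt E}},\qquad E>0.$$ 1. For every $n\ge1$ let $L_n>0$ and let $n-1$ impurities be independent and uniformly distributed over $\Lambda_{L_n}$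 (the joint law for different $n$ is arbitrary). If $n/L_n\to\lambda$ as $n\to\infty$, then almost surely $\mathcal N_{L_n}^\omega(E)\to\mathcal N_\lambda(E)$ for all $E>0$. 2. For every $n\ge1$ let $u^{(n)}_1,\dots,u^{(n)}_{n-1}$ be independent and uniformly distributed over $[-\frac12,\frac12]$ (the joint law for different $n$ is arbitrary), let $n(L)\ge1$ be integers with $n(L)/L\to\lambda$ as $L\to\infty$, and let the impurities in $\Lambda_L$ be $L\,u^{(n(L))}_k$, $1\le k<n(L)$. Then almost surely $\mathcal N_L^\omega(E)\to\mathcal N_\lambda(E)$ as $L\to\infty$, $L$ real, for all $E>0$. 3. The limit has a Lifshitz tail: as $E\downarrow0$, $$\mathcal N_\lambda(E)=\lambda e^{-c\lambda/\sqrt E}\,\bigl\{1+O(e^{-c\lambda/\sqrt E})\bigr\}\qquad\text{and}\qquad \ln\mathcal N_\lambda(E)\sim-\frac{c\lambda}{\sqrt E}.$$ -/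

import Mathlib

open MeasureTheory ProbabilityTheory Filter Topology Set Asymptotics

namespace LuttingerSy

open scoped ContDiff

/-! ### The Dirichlet operator `-Δ/2` on a bounded interval -/

/-- The Hilbert space `L²((a,b))`. -/
abbrev L2 (a b : ℝ) : Type := Lp ℂ 2 (volume.restrict (Ioo a b))

/-- Smooth functions with compact support contained in `(a,b)`. -/
def IsTestFunction (a b : ℝ) (φ : ℝ → ℝ) : Prop :=
  ContDiff ℝ ∞ φ ∧ HasCompactSupport φ ∧ tsupport φ ⊆ Ioo a b

/-- `g` is the weak derivative of `f` on `(a,b)`. -/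
def HasWeakDeriv {a b : ℝ} (f g : L2 a b) : Prop :=
  ∀ φ : ℝ → ℝ, IsTestFunction a b φ →
    ∫ x in Ioo a b, deriv φ x • f x = -∫ x in Ioo a b, φ x • g x

/-- `f` has a representative that is continuous on `[a,b]` and vanishes at both end points. -/
def VanishesAtEndpoints {a b : ℝ} (f : L2 a b) : Prop :=
  ∃ u : ℝ → ℂ, ContinuousOn u (Icc a b) ∧ u =ᵐ[volume.restrict (Ioo a b)] f ∧ u a = 0 ∧ u b = 0

theorem integrable_smul {a b : ℝ} {φ : ℝ → ℝ} (hc : Continuous φ) (hs : HasCompactSupport φ)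
    (f : L2 a b) : Integrable (fun x => φ x • f x) (volume.restrict (Ioo a b)) := by
  obtain ⟨C, hC⟩ := hc.bounded_above_of_compact_support hs
  have hf : Integrable f (volume.restrict (Ioo a b)) :=
    (Lp.memLp f).integrable (by norm_num)
  exact hf.bdd_smul C hc.aestronglyMeasurable (Eventually.of_forall hC)

theorem IsTestFunction.integrable {a b : ℝ} {φ : ℝ → ℝ} (h : IsTestFunction a b φ) (f : L2 a b) :
    Integrable (fun x => φ x • f x) (volume.restrict (Ioo a b)) :=
  integrable_smul h.1.continuous h.2.1 f

theorem IsTestFunction.integrable_deriv {a b : ℝ} {φ : ℝ → ℝ} (h : IsTestFunction a b φ)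
    (f : L2 a b) : Integrable (fun x => deriv φ x • f x) (volume.restrict (Ioo a b)) :=
  integrable_smul (h.1.continuous_deriv (by simp)) h.2.1.deriv f

theorem integral_smul_add {a b : ℝ} {ψ : ℝ → ℝ} {f f' : L2 a b}
    (h : Integrable (fun x => ψ x • f x) (volume.restrict (Ioo a b)))
    (h' : Integrable (fun x => ψ x • f' x) (volume.restrict (Ioo a b))) :
    ∫ x in Ioo a b, ψ x • (f + f' : L2 a b) x =
      (∫ x in Ioo a b, ψ x • f x) + ∫ x in Ioo a b, ψ x • f' x := by
  rw [← integral_add h h']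
  refine integral_congr_ae ?_
  filter_upwards [Lp.coeFn_add f f'] with x hx
  rw [hx, Pi.add_apply, smul_add]

theorem integral_smul_smul {a b : ℝ} (ψ : ℝ → ℝ) (c : ℂ) (f : L2 a b) :
    ∫ x in Ioo a b, ψ x • (c • f : L2 a b) x = c • ∫ x in Ioo a b, ψ x • f x := by
  rw [← integral_smul]
  refine integral_congr_ae ?_
  filter_upwards [Lp.coeFn_smul c f] with x hx
  rw [hx, Pi.smul_apply, smul_comm]

theorem HasWeakDeriv.add {a b : ℝ} {f g f' g' : L2 a b} (h : HasWeakDeriv f g)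
    (h' : HasWeakDeriv f' g') : HasWeakDeriv (f + f') (g + g') := by
  intro φ hφ
  rw [integral_smul_add (hφ.integrable_deriv f) (hφ.integrable_deriv f'),
    integral_smul_add (hφ.integrable g) (hφ.integrable g'), h φ hφ, h' φ hφ, neg_add]

theorem HasWeakDeriv.smul {a b : ℝ} {f g : L2 a b} (c : ℂ) (h : HasWeakDeriv f g) :
    HasWeakDeriv (c • f) (c • g) := by
  intro φ hφ
  rw [integral_smul_smul, integral_smul_smul, h φ hφ, smul_neg]

theorem HasWeakDeriv.zero {a b : ℝ} : HasWeakDeriv (0 : L2 a b) 0 := by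
  have h : ∀ ψ : ℝ → ℝ, ∫ x in Ioo a b, ψ x • (0 : L2 a b) x = 0 := by
    intro ψ
    simpa using integral_smul_smul ψ 0 (0 : L2 a b)
  intro φ _
  rw [h, h, neg_zero]

theorem HasWeakDeriv.eq_zero {a b : ℝ} {g : L2 a b} (h : HasWeakDeriv 0 g) : g = 0 := by
  have h0 : ∀ ψ : ℝ → ℝ, ∫ x in Ioo a b, ψ x • (0 : L2 a b) x = 0 := by
    intro ψ
    simpa using integral_smul_smul ψ 0 (0 : L2 a b)
  have hg : IntegrableOn g (Ioo a b) volume := (Lp.memLp g).integrable (by norm_num)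
  have key := isOpen_Ioo.ae_eq_zero_of_integral_contDiff_smul_eq_zero (μ := volume)
    (f := g) (U := Ioo a b) hg.locallyIntegrableOn (by
      intro φ h1 h2 h3
      have h4 := h φ ⟨h1, h2, h3⟩
      rw [h0, eq_comm, neg_eq_zero] at h4
      rw [← h4, setIntegral_eq_integral_of_forall_compl_eq_zero]
      intro x hx
      rw [image_eq_zero_of_notMem_tsupport (fun hx' => hx (h3 hx')), zero_smul])
  refine Lp.ext ?_
  filter_upwards [(ae_restrict_iff' measurableSet_Ioo).2 key,
    Lp.coeFn_zero ℂ 2 (volume.restrict (Ioo a b))] with x hx hx'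
  rw [hx, hx', Pi.zero_apply]

/-- The graph of the Dirichlet operator on `(a,b)`: the pairs `(f, -f''/2)` where `f` belongs to
the Sobolev space `W²₂((a,b))` and `f(a) = f(b) = 0`. -/
def dirichletGraph (a b : ℝ) : Submodule ℂ (L2 a b × L2 a b) where
  carrier := {p | ∃ f₁ f₂ : L2 a b, HasWeakDeriv p.1 f₁ ∧ HasWeakDeriv f₁ f₂ ∧
    VanishesAtEndpoints p.1 ∧ p.2 = (-(1 / 2) : ℂ) • f₂}
  zero_mem' := by
    refine ⟨0, 0, HasWeakDeriv.zero, HasWeakDeriv.zero, ⟨0, continuousOn_const, ?_, rfl, rfl⟩,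
      by simp⟩
    exact (Lp.coeFn_zero ℂ 2 _).symm
  add_mem' := by
    rintro ⟨f, g⟩ ⟨f', g'⟩ ⟨f₁, f₂, h₁, h₂, ⟨u, hu, huf, hua, hub⟩, hg⟩
      ⟨f₁', f₂', h₁', h₂', ⟨u', hu', huf', hua', hub'⟩, hg'⟩
    refine ⟨f₁ + f₁', f₂ + f₂', h₁.add h₁', h₂.add h₂', ⟨u + u', hu.add hu', ?_, ?_, ?_⟩, ?_⟩
    · exact (huf.add huf').trans (Lp.coeFn_add f f').symm
    · simp [hua, hua']
    · simp [hub, hub']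
    · simp only [Prod.mk_add_mk] at *
      rw [hg, hg', smul_add]
  smul_mem' := by
    rintro c ⟨f, g⟩ ⟨f₁, f₂, h₁, h₂, ⟨u, hu, huf, hua, hub⟩, hg⟩
    refine ⟨c • f₁, c • f₂, h₁.smul c, h₂.smul c, ⟨c • u, hu.const_smul c, ?_, ?_, ?_⟩, ?_⟩
    · exact (huf.const_smul c).trans (Lp.coeFn_smul c f).symm
    · simp [hua]
    · simp [hub]
    · simp only [Prod.smul_mk] at *
      rw [hg, smul_comm]

/-- The operator `h_D((a,b)) = -Δ/2` with Dirichlet conditions at `a` and `b`. -/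
noncomputable def dirichletOp (a b : ℝ) : L2 a b →ₗ.[ℂ] L2 a b :=
  (dirichletGraph a b).toLinearPMap

/-- Weak derivatives being unique, `dirichletOp` really has the prescribed graph. -/
theorem dirichletOp_graph (a b : ℝ) : (dirichletOp a b).graph = dirichletGraph a b := by
  refine Submodule.toLinearPMap_graph_eq _ ?_
  rintro ⟨f, g⟩ ⟨f₁, f₂, h₁, h₂, -, hg⟩ hf
  simp only at hf hg h₁
  subst hf
  have h₃ := h₁.eq_zero
  subst h₃
  rw [hg, h₂.eq_zero, smul_zero]

/-! ### Orthogonal sums and counting functions of operators -/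

/-- The orthogonal sum `⊕ⱼ T j` of finitely many operators, with domain `⊕ⱼ dom (T j)`. -/
noncomputable def directSumOp {ι : Type} [Fintype ι] {H : ι → Type}
    [∀ j, NormedAddCommGroup (H j)] [∀ j, InnerProductSpace ℂ (H j)]
    (T : ∀ j, H j →ₗ.[ℂ] H j) : PiLp 2 H →ₗ.[ℂ] PiLp 2 H where
  domain :=
    { carrier := {f | ∀ j, f j ∈ (T j).domain}
      zero_mem' := fun j => (T j).domain.zero_mem
      add_mem' := fun hf hg j => (T j).domain.add_mem (hf j) (hg j)
      smul_mem' := fun c _ hf j => (T j).domain.smul_mem c (hf j) }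
  toFun :=
    { toFun := fun f => WithLp.toLp 2 fun j => T j ⟨f.1 j, f.2 j⟩
      map_add' := by
        intro f g
        ext1 j
        exact (T j).map_add ⟨f.1 j, f.2 j⟩ ⟨g.1 j, g.2 j⟩
      map_smul' := by
        intro c f
        ext1 j
        exact (T j).map_smul c ⟨f.1 j, f.2 j⟩ }

/-- The number of eigenvalues of `T` that are strictly below `E`, counted with multiplicity: the
dimension of the space spanned by the corresponding eigenvectors. -/
noncomputable def eigenvalueCount {H : Type} [NormedAddCommGroup H] [InnerProductSpace ℂ H]
    (T : H →ₗ.[ℂ] H) (E : ℝ) : ℕ :=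
  Module.finrank ℂ (Submodule.span ℂ
    {f : H | ∃ μ : ℝ, μ < E ∧ ∃ hf : f ∈ T.domain, T ⟨f, hf⟩ = (μ : ℂ) • f})

/-! ### The finite-volume Luttinger-Sy model -/

/-- The box `Λ = [-L/2, L/2]`. -/
def box (L : ℝ) : Set ℝ := Icc (-(L / 2)) (L / 2)

/-- The end points `-L/2 = x₀ ≤ x₁ ≤ ⋯ ≤ xₘ ≤ xₘ₊₁ = L/2` of the `m + 1` intervals cut out of
`[-L/2, L/2]` by `m` impurities, where `x₁, …, xₘ` is the increasing rearrangement of the impurity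
positions `y`. -/
noncomputable def nodes (L : ℝ) {m : ℕ} (y : Fin m → ℝ) : Fin (m + 2) → ℝ :=
  Fin.cons (-(L / 2)) (Fin.snoc (y ∘ Tuple.sort y) (L / 2) : Fin (m + 1) → ℝ)

/-- The Luttinger-Sy Hamiltonian in `[-L/2, L/2]` with `m` impurities at `y`: the orthogonal sum
of the Dirichlet operators on the `m + 1` intervals between consecutive nodes. -/
noncomputable def hamiltonian (L : ℝ) {m : ℕ} (y : Fin m → ℝ) :
    PiLp 2 (fun j : Fin (m + 1) => L2 (nodes L y j.castSucc) (nodes L y j.succ)) →ₗ.[ℂ]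
      PiLp 2 (fun j : Fin (m + 1) => L2 (nodes L y j.castSucc) (nodes L y j.succ)) :=
  directSumOp fun j => dirichletOp (nodes L y j.castSucc) (nodes L y j.succ)

/-- The finite-volume integrated density of states: the number, per unit length, of eigenvalues
of the Hamiltonian strictly below `E`, counted with multiplicity. -/
noncomputable def finiteIDS (L : ℝ) {m : ℕ} (y : Fin m → ℝ) (E : ℝ) : ℝ :=
  (eigenvalueCount (hamiltonian L y) E : ℝ) / L

/-- The random points `Y 0, …, Y (m-1)` are independent and uniformly distributed over
`[-L/2, L/2]`. -/
structure IsUniformImpurities {Ω : Type*} [MeasurableSpace Ω] (P : Measure Ω) (L : ℝ) {m : ℕ}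
    (Y : Fin m → Ω → ℝ) : Prop where
  measurable : ∀ k, Measurable (Y k)
  indep : iIndepFun Y P
  uniform : ∀ k, pdf.IsUniform (Y k) (box L) P volume

/-! ### The limit -/

/-- The constant `c = π / √2`. -/
noncomputable def cLS : ℝ := Real.pi / √2

/-- `N_λ(E) = λ e^{-cλ/√E} / (1 - e^{-cλ/√E})`, for `E > 0`. -/
noncomputable def limitIDS (lam E : ℝ) : ℝ :=
  lam * (Real.exp (-(cLS * lam / √E)) / (1 - Real.exp (-(cLS * lam / √E))))

end LuttingerSy

namespace LuttingerSy

/-! ### The bounded difference inequality -/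

/-! The operator enters only through the lengths of the intervals. On an interval of length `l` the
Dirichlet eigenvalues are `(kπ/l)²/2`, `k ≥ 1`, and the `k`-th one lies below `E` iff `k * a < l`
with `a = c/√E`. Hence the number of eigenvalues below `E` is the sum over the intervals of the
number of `k ≥ 1` with `k * a < l` (`eigenvalueCount_hamiltonian`). If the number of intervals
longer than `t`, per unit length, tends to `λ e^{-λt}`, then summing over `t = a, 2a, …` gives the
geometric series `λ ∑ e^{-λka}`, which is the limit claimed.

The count of long intervals is a concentration statement. Rescale the box to `[-1/2, 1/2]`. An
interval starting at an impurity is longer than `t` iff that impurity is `isolated`, and the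
expected number of isolated points among `m` is exactly `m (1 - t)^m`, which for `t = s/m` is
asymptotic to `m e^{-s}`. Moving one point changes the number by at most two, so by the bounded
difference inequality deviations of order `m` have exponentially small probability. Borel–Cantelli
then gives almost sure convergence (`ae_tendsto_isolated`); it needs no independence between samples
of different sizes, so their joint law is irrelevant.

Countably many rational `s` suffice, because the count is monotone in `s` and the limit continuous.
Outside one null set the sample is therefore `IsTypical`, and the rest is deterministic: it holds
along any filter on which `L → ∞` and `(m + 1)/L → λ`, in particular for real `L`, and for all `E`
at once.

Exchanging the limit with the infinite sum over `k` requires that long intervals carry little total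
length. This follows because the lengths add up to exactly `L`, while the limiting distribution
already accounts for all of it: `∫ λ e^{-λt} dt = 1` (`tendsto_sum_multiplesBelow`).

On the operator side, the du Bois-Reymond lemma turns a weak eigenfunction into a classical solution
of `u'' = -2μu` with zero boundary values, hence into a multiple of a sine (`eq_smul_sineLp`). The
sines on all intervals together form an orthogonal basis of the span of the eigenvectors below `E`.
-/

/-- **McDiarmid's inequality** (with a non-optimal constant): a measurable function of `n`
independent variables that changes by at most `c` when one variable is changed is sub-Gaussian. -/
theorem hasSubgaussianMGF_of_bounded_differences {X : Type*} [MeasurableSpace X] (μ : Measure X)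
    [IsProbabilityMeasure μ] (c : NNReal) (n : ℕ) (f : (Fin n → X) → ℝ) (hf : Measurable f)
    (hb : ∃ C, ∀ x, |f x| ≤ C)
    (hd : ∀ x i z, |f (Function.update x i z) - f x| ≤ c) :
    HasSubgaussianMGF (fun x => f x - ∫ y, f y ∂(Measure.pi fun _ => μ)) (n * c ^ 2)
      (Measure.pi fun _ : Fin n => μ) := by
  induction n with
  | zero =>
    have h : (fun x => f x - ∫ y, f y ∂(Measure.pi fun _ : Fin 0 => μ)) = fun _ => 0 := by
      funext x
      have : f = fun _ => f x := funext fun y => congrArg f (Subsingleton.elim _ _)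
      rw [this]
      simp
    rw [h]
    simp
  | succ n ih =>
    obtain ⟨C, hC⟩ := hb
    have hne : Nonempty X := μ.nonempty_of_neZero
    obtain ⟨z₀⟩ := hne
    set π := Measure.pi fun _ : Fin n => μ with hπ
    have mp := (measurePreserving_piFinSuccAbove (fun _ : Fin (n + 1) => μ) 0).symm
    set F : X × (Fin n → X) → ℝ := fun p => f (Fin.cons p.1 p.2) with hF
    have hFe : ∀ p, f ((MeasurableEquiv.piFinSuccAbove (fun _ => X) 0).symm p) = F p := by
      intro p
      simp [hF, MeasurableEquiv.piFinSuccAbove_symm_apply, Fin.insertNthEquiv]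
    have hFm : Measurable F := by
      have : F = f ∘ (MeasurableEquiv.piFinSuccAbove (fun _ => X) 0).symm :=
        funext fun p => (hFe p).symm
      rw [this]
      exact hf.comp (MeasurableEquiv.measurable _)
    have hFC : ∀ p, |F p| ≤ C := fun p => hC _
    have hint : ∀ h : ℝ → ℝ, ∫ x, h (f x) ∂(Measure.pi fun _ : Fin (n + 1) => μ) =
        ∫ p, h (F p) ∂(μ.prod π) := by
      intro h
      rw [← mp.integral_comp' (g := fun x => h (f x))]
      simp_rw [hFe]
      rfl
    -- Averaging over the first coordinate preserves the bounded differences, so the induction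
    -- hypothesis applies to `g`; what remains, `F - g`, is centred and bounded in the first
    -- variable, and Hoeffding's lemma bounds its exponential moment.
    set g : (Fin n → X) → ℝ := fun y => ∫ x, F (x, y) ∂μ with hg
    have hgm : Measurable g := by
      have := hFm.stronglyMeasurable.integral_prod_left' (μ := μ)
      exact this.measurable
    have hsec : ∀ y, Measurable fun x => F (x, y) := fun y => hFm.comp (by fun_prop)
    have hseci : ∀ y, Integrable (fun x => F (x, y)) μ := fun y =>
      Integrable.of_bound (hsec y).aestronglyMeasurable C (Eventually.of_forall fun x => hFC _)
    have hgC : ∀ y, |g y| ≤ C := by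
      intro y
      have := norm_integral_le_of_norm_le_const (μ := μ) (f := fun x => F (x, y)) (C := C)
        (Eventually.of_forall fun x => hFC _)
      simpa using this
    have hgd : ∀ x i z, |g (Function.update x i z) - g x| ≤ c := by
      intro x i z
      have h1 : g (Function.update x i z) - g x =
          ∫ w, (F (w, Function.update x i z) - F (w, x)) ∂μ :=
        (integral_sub (hseci _) (hseci _)).symm
      rw [h1]
      have := norm_integral_le_of_norm_le_const (μ := μ)
        (f := fun w => F (w, Function.update x i z) - F (w, x)) (C := c)
        (Eventually.of_forall fun w => by
          have := hd (Fin.cons w x) i.succ z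
          rw [← Fin.cons_update] at this
          exact this)
      simpa using this
    have IH := ih g hgm ⟨C, hgC⟩ hgd
    have hFi : Integrable F (μ.prod π) :=
      Integrable.of_bound hFm.aestronglyMeasurable C (Eventually.of_forall hFC)
    have hmean : ∫ y, f y ∂(Measure.pi fun _ : Fin (n + 1) => μ) = ∫ y, g y ∂π := by
      rw [hint fun r => r, integral_prod_symm _ hFi]
    set m := ∫ y, g y ∂π with hm
    have hexpb : ∀ t r : ℝ, |r| ≤ C → |Real.exp (t * (r - m))| ≤ Real.exp (|t| * (C + |m|)) := by
      intro t r hr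
      rw [abs_of_pos (Real.exp_pos _), Real.exp_le_exp]
      calc t * (r - m) ≤ |t * (r - m)| := le_abs_self _
        _ = |t| * |r - m| := abs_mul _ _
        _ ≤ |t| * (C + |m|) := by
          gcongr
          exact (abs_sub _ _).trans (by gcongr)
    rw [hmean]
    constructor
    · intro t
      exact Integrable.of_bound (by fun_prop) (Real.exp (|t| * (C + |m|)))
        (Eventually.of_forall fun x => hexpb t _ (hC x))
    · intro t
      have hFi' : Integrable (fun p => Real.exp (t * (F p - m))) (μ.prod π) :=
        Integrable.of_bound (by fun_prop) (Real.exp (|t| * (C + |m|)))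
          (Eventually.of_forall fun x => hexpb t _ (hFC x))
      have hsplit : ∀ y, ∫ x, Real.exp (t * (F (x, y) - m)) ∂μ =
          Real.exp (t * (g y - m)) * ∫ x, Real.exp (t * (F (x, y) - g y)) ∂μ := by
        intro y
        rw [← integral_const_mul]
        congr 1 with x
        rw [← Real.exp_add]
        ring_nf
      have hoeff : ∀ y, ∫ x, Real.exp (t * (F (x, y) - g y)) ∂μ ≤ Real.exp (c ^ 2 * t ^ 2 / 2) := by
        intro y
        -- Every value of the section is within `c` of its value at the reference point `z₀`. The
        -- range has length `2c`, and the variance proxy is half of it, squared.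
        have h := hasSubgaussianMGF_of_mem_Icc (μ := μ) (X := fun x => F (x, y))
          (a := F (z₀, y) - c) (b := F (z₀, y) + c) (hsec y).aemeasurable
          (Eventually.of_forall fun x => by
            have h1 := hd (Fin.cons z₀ y) 0 x
            rw [Fin.update_cons_zero] at h1
            have h2 := abs_le.1 h1
            exact ⟨by simp only [hF]; linarith, by simp only [hF]; linarith⟩)
        have h2 := h.mgf_le t
        have h3 : (((‖F (z₀, y) + c - (F (z₀, y) - c)‖₊ / 2) ^ 2 : NNReal) : ℝ) = c ^ 2 := by
          have : F (z₀, y) + c - (F (z₀, y) - c) = 2 * c := by ring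
          rw [this]
          push_cast
          rw [Real.norm_of_nonneg (by positivity)]
          ring
        rw [h3] at h2
        exact h2
      have hgi : Integrable (fun y => Real.exp (t * (g y - m))) π := IH.integrable_exp_mul t
      have h4 : mgf (fun x => f x - m) (Measure.pi fun _ : Fin (n + 1) => μ) t =
          ∫ y, ∫ x, Real.exp (t * (F (x, y) - m)) ∂μ ∂π := by
        rw [mgf, hint fun r => Real.exp (t * (r - m)), integral_prod_symm _ hFi']
      have h5 := IH.mgf_le t
      calc mgf (fun x => f x - m) (Measure.pi fun _ : Fin (n + 1) => μ) t
          = ∫ y, ∫ x, Real.exp (t * (F (x, y) - m)) ∂μ ∂π := h4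
        _ ≤ ∫ y, Real.exp (t * (g y - m)) * Real.exp (c ^ 2 * t ^ 2 / 2) ∂π := by
          refine integral_mono hFi'.integral_prod_right (hgi.mul_const _) fun y => ?_
          simp only
          rw [hsplit]
          gcongr
          exact hoeff y
        _ = (∫ y, Real.exp (t * (g y - m)) ∂π) * Real.exp (c ^ 2 * t ^ 2 / 2) :=
          integral_mul_const _ _
        _ ≤ Real.exp ((n * c ^ 2 : NNReal) * t ^ 2 / 2) * Real.exp (c ^ 2 * t ^ 2 / 2) := by
          gcongr
          exact h5
        _ = Real.exp (((n + 1 : ℕ) * c ^ 2 : NNReal) * t ^ 2 / 2) := by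
          rw [← Real.exp_add]
          push_cast
          ring_nf

/-- Two-sided deviation bound for functions with bounded differences. -/
theorem measureReal_abs_sub_integral_ge_le {X : Type*} [MeasurableSpace X] (μ : Measure X)
    [IsProbabilityMeasure μ] (c : NNReal) (n : ℕ) (f : (Fin n → X) → ℝ) (hf : Measurable f)
    (hb : ∃ C, ∀ x, |f x| ≤ C)
    (hd : ∀ x i z, |f (Function.update x i z) - f x| ≤ c) {ε : ℝ} (hε : 0 ≤ ε) :
    (Measure.pi fun _ : Fin n => μ).real
        {x | ε ≤ |f x - ∫ y, f y ∂(Measure.pi fun _ => μ)|} ≤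
      2 * Real.exp (-ε ^ 2 / (2 * (n * c ^ 2))) := by
  have h := hasSubgaussianMGF_of_bounded_differences μ c n f hf hb hd
  have h1 := h.measure_ge_le hε
  have h2 := h.neg.measure_ge_le hε
  push_cast at h1 h2
  calc _ ≤ (Measure.pi fun _ : Fin n => μ).real
        ({x | ε ≤ f x - ∫ y, f y ∂(Measure.pi fun _ => μ)} ∪
          {x | ε ≤ (-fun x => f x - ∫ y, f y ∂(Measure.pi fun _ => μ)) x}) := by
        refine measureReal_mono fun x hx => ?_
        rw [mem_ofPred_eq, le_abs] at hx
        exact hx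
    _ ≤ _ := measureReal_union_le _ _
    _ ≤ _ := by linarith

/-! ### Isolated points of a uniform sample -/

open Classical in
/-- The indices of the points of `y` that have no other point of `y`, and not the end point `1/2`,
within distance `t` to their right. -/
noncomputable def isolated (t : ℝ) {m : ℕ} (y : Fin m → ℝ) : Finset (Fin m) :=
  {k | y k + t < 1 / 2 ∧ ∀ i, i ≠ k → y i ∉ Icc (y k) (y k + t)}

theorem mem_isolated {t : ℝ} {m : ℕ} {y : Fin m → ℝ} {k : Fin m} :
    k ∈ isolated t y ↔ y k + t < 1 / 2 ∧ ∀ i, i ≠ k → y i ∉ Icc (y k) (y k + t) := by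
  simp [isolated]

theorem isolated_anti {t t' : ℝ} (h : t ≤ t') {m : ℕ} (y : Fin m → ℝ) :
    isolated t' y ⊆ isolated t y := by
  intro k hk
  rw [mem_isolated] at hk ⊢
  exact ⟨by linarith [hk.1], fun i hi h' => hk.2 i hi ⟨h'.1, h'.2.trans (by linarith)⟩⟩

/-- Changing one point changes the number of isolated points by at most two. -/
theorem card_isolated_update_le (t : ℝ) {m : ℕ} (y y' : Fin m → ℝ) (j : Fin m)
    (h : ∀ i, i ≠ j → y i = y' i) : (isolated t y).card ≤ (isolated t y').card + 2 := by
  classical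
  -- `W` collects the indices that are isolated once the point `j` is deleted. Both samples agree
  -- there; one unit of the bound is for `j` itself, the other for the points of `W` that `y' j`
  -- spoils.
  set W : Finset (Fin m) := {k | k ≠ j ∧ y' k + t < 1 / 2 ∧
    ∀ i, i ≠ k → i ≠ j → y' i ∉ Icc (y' k) (y' k + t)} with hW
  have h1 : isolated t y ⊆ insert j W := by
    intro k hk
    rw [mem_isolated] at hk
    rw [Finset.mem_insert]
    by_cases hkj : k = j
    · exact Or.inl hkj
    · right
      rw [hW, Finset.mem_filter]
      refine ⟨Finset.mem_univ _, hkj, h k hkj ▸ hk.1, fun i hi hij => ?_⟩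
      rw [← h k hkj, ← h i hij]
      exact hk.2 i hi
  have hbad : ∀ k ∈ W \ isolated t y', y' j ∈ Icc (y' k) (y' k + t) := by
    intro k hk
    rw [Finset.mem_sdiff, hW, Finset.mem_filter, mem_isolated] at hk
    obtain ⟨⟨-, hkj, hk1, hk2⟩, hk3⟩ := hk
    by_contra hj
    refine hk3 ⟨hk1, fun i hi => ?_⟩
    by_cases hij : i = j
    · rwa [hij]
    · exact hk2 i hi hij
  have h2 : (W \ isolated t y').card ≤ 1 := by
    rw [Finset.card_le_one]
    -- If `y' j` lay in the windows of two points of `W`, the right-hand one would lie between the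
    -- left-hand one and `y' j`, hence in the window of the left-hand one.
    have key : ∀ k ∈ W \ isolated t y', ∀ k' ∈ W \ isolated t y', y' k ≤ y' k' → k = k' := by
      intro k hk k' hk' hle
      by_contra hne
      have hb := hbad k hk
      have hb' := hbad k' hk'
      rw [Finset.mem_sdiff, hW, Finset.mem_filter] at hk hk'
      exact hk.1.2.2.2 k' (Ne.symm hne) hk'.1.2.1 ⟨hle, hb'.1.trans hb.2⟩
    intro k hk k' hk'
    rcases le_total (y' k) (y' k') with hle | hle
    · exact key k hk k' hk' hle
    · exact (key k' hk' k hk hle).symm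
  have h3 := Finset.card_le_card h1
  have h4 := Finset.card_insert_le j W
  have h5 := Finset.card_le_card_sdiff_add_card (s := W) (t := isolated t y')
  omega

theorem measurableSet_mem_isolated (t : ℝ) {m : ℕ} (k : Fin m) :
    MeasurableSet {y : Fin m → ℝ | k ∈ isolated t y} := by
  simp only [mem_isolated, mem_Icc, not_and, not_le]
  measurability

theorem card_isolated_eq_sum (t : ℝ) {m : ℕ} (y : Fin m → ℝ) :
    ((isolated t y).card : ℝ) =
      ∑ k, {y : Fin m → ℝ | k ∈ isolated t y}.indicator (fun _ => (1 : ℝ)) y := by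
  classical
  simp [indicator_apply]

theorem measurable_card_isolated (t : ℝ) {m : ℕ} :
    Measurable fun y : Fin m → ℝ => ((isolated t y).card : ℝ) := by
  simp_rw [card_isolated_eq_sum]
  exact Finset.measurable_sum _ fun k _ =>
    measurable_const.indicator (measurableSet_mem_isolated t k)

/-- The uniform distribution on `[-1/2, 1/2]`. -/
noncomputable def unif : Measure ℝ := volume[|box 1]

theorem volume_box_one : volume (box 1) = 1 := by
  rw [box, Real.volume_Icc]
  norm_num

theorem unif_eq : unif = volume.restrict (box 1) := by
  rw [unif, ProbabilityTheory.cond, volume_box_one, inv_one, one_smul]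

instance : IsProbabilityMeasure unif := by
  rw [unif]
  exact cond_isProbabilityMeasure_of_finite (by simp [volume_box_one]) (by simp [volume_box_one])

instance : NullSingletonClass unif := by
  rw [unif_eq]
  infer_instance

theorem unif_compl_Icc {x t : ℝ} (hx : -(1 / 2) ≤ x) (ht : 0 ≤ t) (hxt : x + t < 1 / 2) :
    unif (Icc x (x + t))ᶜ = ENNReal.ofReal (1 - t) := by
  have h : unif (Icc x (x + t)) = ENNReal.ofReal t := by
    rw [unif_eq, Measure.restrict_apply measurableSet_Icc, inter_eq_left.2, Real.volume_Icc]
    · congr 1; ring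
    · exact Icc_subset_Icc hx hxt.le
  rw [prob_compl_eq_one_sub measurableSet_Icc, h, ENNReal.ofReal_sub _ ht, ENNReal.ofReal_one]

theorem unif_add_lt {t : ℝ} (ht : 0 ≤ t) :
    unif {x | x + t < 1 / 2} = ENNReal.ofReal (1 - t) := by
  have h : {x : ℝ | x + t < 1 / 2} ∩ box 1 = Ico (-(1 / 2)) (1 / 2 - t) := by
    ext x
    simp only [box, mem_inter_iff, mem_ofPred_eq, mem_Icc, mem_Ico]
    constructor
    · rintro ⟨h1, h2, h3⟩
      exact ⟨h2, by linarith⟩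
    · rintro ⟨h1, h2⟩
      exact ⟨by linarith, h1, by linarith⟩
  rw [unif_eq, Measure.restrict_apply (measurableSet_lt (by fun_prop) (by fun_prop)), h,
    Real.volume_Ico]
  congr 1; ring

/-- Condition on the position `x` of the `k`-th point. The end point condition has probability `1 -
t` and keeps the window `[x, x + t]` inside the box; each of the `n` other points then avoids it
with probability `1 - t`. The formula is thus exact, without boundary correction. -/
theorem pi_unif_mem_isolated {t : ℝ} (ht : 0 ≤ t) (n : ℕ) (k : Fin (n + 1)) :
    (Measure.pi fun _ : Fin (n + 1) => unif) {y | k ∈ isolated t y} =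
      ENNReal.ofReal (1 - t) ^ (n + 1) := by
  have mp := (measurePreserving_piFinSuccAbove (fun _ : Fin (n + 1) => unif) k).symm
  have hpre : (MeasurableEquiv.piFinSuccAbove (fun _ : Fin (n + 1) => ℝ) k).symm ⁻¹'
      {y | k ∈ isolated t y} =
      {p | p.1 + t < 1 / 2 ∧ ∀ i, p.2 i ∉ Icc p.1 (p.1 + t)} := by
    ext ⟨x, z⟩
    simp only [mem_preimage, mem_ofPred_eq, mem_isolated, MeasurableEquiv.piFinSuccAbove_symm_apply,
      Fin.insertNthEquiv, Equiv.coe_fn_mk, Fin.insertNth_apply_same]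
    refine and_congr_right fun _ => ?_
    rw [k.forall_iff_succAbove]
    simp [Fin.succAbove_ne]
  have hms := mp.measurable (measurableSet_mem_isolated t k)
  rw [← mp.measure_preimage (measurableSet_mem_isolated t k).nullMeasurableSet]
  rw [hpre] at hms ⊢
  rw [Measure.prod_apply hms]
  have hsec : ∀ᵐ x ∂unif, (Measure.pi fun _ : Fin n => unif)
      (Prod.mk x ⁻¹' {p : ℝ × (Fin n → ℝ) | p.1 + t < 1 / 2 ∧ ∀ i, p.2 i ∉ Icc p.1 (p.1 + t)}) =
      {x : ℝ | x + t < 1 / 2}.indicator (fun _ => ENNReal.ofReal (1 - t) ^ n) x := by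
    have hx : ∀ᵐ x ∂unif, x ∈ box 1 := by
      rw [unif_eq]
      exact ae_restrict_mem measurableSet_Icc
    filter_upwards [hx] with x hx
    by_cases h : x + t < 1 / 2
    · have : Prod.mk x ⁻¹' {p : ℝ × (Fin n → ℝ) | p.1 + t < 1 / 2 ∧
          ∀ i, p.2 i ∉ Icc p.1 (p.1 + t)} = univ.pi fun _ => (Icc x (x + t))ᶜ := by
        ext z
        simp only [mem_preimage, mem_ofPred_eq, Set.mem_pi, mem_compl_iff, h, true_and, mem_univ,
          true_implies]
      rw [this, Measure.pi_pi, indicator_of_mem (by exact h)]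
      rw [Finset.prod_congr rfl fun i _ => unif_compl_Icc hx.1 ht h]
      simp
    · rw [indicator_of_notMem (by exact h)]
      rw [show Prod.mk x ⁻¹' {p : ℝ × (Fin n → ℝ) | p.1 + t < 1 / 2 ∧
          ∀ i, p.2 i ∉ Icc p.1 (p.1 + t)} = ∅ from eq_empty_of_forall_notMem fun z hz => h hz.1]
      simp
  rw [lintegral_congr_ae hsec, lintegral_indicator_const
    (measurableSet_lt (by fun_prop) (by fun_prop)), unif_add_lt ht, pow_succ]

theorem integral_card_isolated {t : ℝ} (ht : 0 ≤ t) (ht1 : t ≤ 1) (m : ℕ) :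
    ∫ y, ((isolated t y).card : ℝ) ∂(Measure.pi fun _ : Fin m => unif) = m * (1 - t) ^ m := by
  simp_rw [card_isolated_eq_sum]
  rw [integral_finsetSum _ fun k _ =>
    (integrable_const _).indicator (measurableSet_mem_isolated t k)]
  have : ∀ k : Fin m, ∫ y, {y : Fin m → ℝ | k ∈ isolated t y}.indicator (fun _ => (1 : ℝ)) y
      ∂(Measure.pi fun _ : Fin m => unif) = (1 - t) ^ m := by
    intro k
    rw [integral_indicator_const _ (measurableSet_mem_isolated t k), smul_eq_mul, mul_one]
    obtain ⟨n, rfl⟩ : ∃ n, m = n + 1 := ⟨m - 1, by have := k.2; omega⟩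
    rw [measureReal_def, pi_unif_mem_isolated ht, ENNReal.toReal_pow,
      ENNReal.toReal_ofReal (by linarith)]
  simp [this]

/-! ### Almost sure behaviour of uniform samples -/

section

variable {Ω : Type*} [MeasurableSpace Ω] {P : Measure Ω}

theorem ae_mem_box {m : ℕ} {U : Fin m → Ω → ℝ} (hU : IsUniformImpurities P 1 U) :
    ∀ᵐ ω ∂P, ∀ k, U k ω ∈ box 1 := by
  rw [ae_all_iff]
  intro k
  refine ae_of_ae_map (hU.measurable k).aemeasurable (p := fun x => x ∈ box 1) ?_
  rw [show P.map (U k) = unif from hU.uniform k, unif_eq]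
  exact ae_restrict_mem measurableSet_Icc

variable [IsProbabilityMeasure P]

theorem IsUniformImpurities.map_eq {m : ℕ} {U : Fin m → Ω → ℝ} (hU : IsUniformImpurities P 1 U) :
    P.map (fun ω k => U k ω) = Measure.pi fun _ => unif := by
  rw [(iIndepFun_iff_map_fun_eq_pi_map fun k => (hU.measurable k).aemeasurable).1 hU.indep]
  congr 1 with k : 1
  exact hU.uniform k

theorem ae_tendsto_isolated {U : ∀ m : ℕ, Fin m → Ω → ℝ}
    (hU : ∀ m, IsUniformImpurities P 1 (U m)) {s : ℝ} (hs : 0 < s) :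
    ∀ᵐ ω ∂P, Tendsto (fun m : ℕ => ((isolated (s / m) fun k => U m k ω).card : ℝ) / m) atTop
      (𝓝 (Real.exp (-s))) := by
  set M : ℕ → ℝ := fun m =>
    ∫ y, ((isolated (s / m) y).card : ℝ) ∂(Measure.pi fun _ : Fin m => unif) with hM
  -- Borel–Cantelli for each of the countably many tolerances `1/(q + 1)`.
  have hdev : ∀ q : ℕ, ∀ᵐ ω ∂P, ∀ᶠ m : ℕ in atTop,
      |((isolated (s / m) fun k => U m k ω).card : ℝ) - M m| < 1 / ((q : ℝ) + 1) * m := by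
    intro q
    set ε : ℝ := 1 / ((q : ℝ) + 1) with hε
    have hε0 : 0 < ε := by positivity
    set B : ∀ m : ℕ, Set (Fin m → ℝ) := fun m =>
      {y | ε * m ≤ |((isolated (s / m) y).card : ℝ) - M m|} with hB
    have hBm : ∀ m, MeasurableSet (B m) := fun m =>
      measurableSet_le measurable_const ((measurable_card_isolated _).sub_const _).abs
    have hle : ∀ m : ℕ, P {ω | (fun k => U m k ω) ∈ B m} ≤
        ENNReal.ofReal (2 * Real.exp (-(ε ^ 2 / 8)) ^ m) := by
      intro m
      have h1 : P {ω | (fun k => U m k ω) ∈ B m} = (Measure.pi fun _ => unif) (B m) := by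
        rw [← (hU m).map_eq, Measure.map_apply (measurable_pi_iff.2 (hU m).measurable) (hBm m)]
        rfl
      rw [h1, ← ofReal_measureReal]
      refine ENNReal.ofReal_le_ofReal ?_
      refine (measureReal_abs_sub_integral_ge_le unif 2 m
        (fun y => ((isolated (s / m) y).card : ℝ)) (measurable_card_isolated _)
        ⟨m, fun y => ?_⟩ (fun y i z => ?_) (ε := ε * m) (by positivity)).trans_eq ?_
      · rw [abs_of_nonneg (by positivity)]
        exact_mod_cast (Finset.card_le_univ _).trans_eq (Fintype.card_fin m)
      · have h1 := card_isolated_update_le (s / m) y (Function.update y i z) i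
          (fun j hj => (Function.update_of_ne hj _ _).symm)
        have h2 := card_isolated_update_le (s / m) (Function.update y i z) y i
          (fun j hj => Function.update_of_ne hj _ _)
        rw [abs_le]
        have h1' : ((isolated (s / m) y).card : ℝ) ≤
          (isolated (s / m) (Function.update y i z)).card + 2 := by exact_mod_cast h1
        have h2' : ((isolated (s / m) (Function.update y i z)).card : ℝ) ≤
          (isolated (s / m) y).card + 2 := by exact_mod_cast h2
        push_cast
        constructor <;> linarith
      -- With difference constant 2 the exponent is `-(εm)²/(2 · 4m) = -mε²/8`, so the bounds form a
      -- geometric series. For `m = 0` the quotient `0/0` is zero, which agrees.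
      · rw [← Real.exp_nat_mul]
        congr 2
        rcases Nat.eq_zero_or_pos m with rfl | hm
        · simp
        · have : (m : ℝ) ≠ 0 := by positivity
          push_cast
          field_simp
          norm_num
    have hsum : ∑' m, P {ω | (fun k => U m k ω) ∈ B m} ≠ ⊤ := by
      refine ne_top_of_le_ne_top ?_ (ENNReal.tsum_le_tsum hle)
      have hsm : Summable fun m : ℕ => 2 * Real.exp (-(ε ^ 2 / 8)) ^ m :=
        (summable_geometric_of_lt_one (Real.exp_pos _).le
          (Real.exp_lt_one_iff.2 (by have := pow_pos hε0 2; linarith))).mul_left 2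
      exact hsm.tsum_ofReal_ne_top
    filter_upwards [ae_eventually_notMem hsum] with ω hω
    filter_upwards [hω] with m hm
    simpa [hB] using hm
  have hmean : Tendsto (fun m : ℕ => M m / m) atTop (𝓝 (Real.exp (-s))) := by
    refine (Real.tendsto_one_add_div_pow_exp (-s)).congr' ?_
    filter_upwards [eventually_ge_atTop (⌈s⌉₊), eventually_gt_atTop 0] with m hm hm0
    have hm0' : (0 : ℝ) < m := by exact_mod_cast hm0
    have : s / m ≤ 1 := by
      rw [div_le_one hm0']
      exact (Nat.le_ceil s).trans (by exact_mod_cast hm)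
    rw [hM]
    simp only
    rw [integral_card_isolated (by positivity) this, mul_div_cancel_left₀ _ hm0'.ne']
    ring
  filter_upwards [ae_all_iff.2 hdev] with ω hω
  have hdiff : Tendsto (fun m : ℕ => ((isolated (s / m) fun k => U m k ω).card : ℝ) / m - M m / m)
      atTop (𝓝 0) := by
    rw [Metric.tendsto_nhds]
    intro δ hδ
    obtain ⟨q, hq⟩ := exists_nat_one_div_lt hδ
    filter_upwards [hω q, eventually_gt_atTop 0] with m hm hm0
    have hm0' : (0 : ℝ) < m := by exact_mod_cast hm0
    rw [dist_zero_right, Real.norm_eq_abs, ← sub_div, abs_div, abs_of_pos hm0', div_lt_iff₀ hm0']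
    exact hm.trans (by gcongr)
  simpa using hdiff.add hmean

/-- The diagonal is null for a product of atomless laws. Ties must be excluded because coinciding
points are never isolated, although the last of them may start a long interval. -/
theorem ae_injective {m : ℕ} {U : Fin m → Ω → ℝ} (hU : IsUniformImpurities P 1 U) :
    ∀ᵐ ω ∂P, Function.Injective fun k => U k ω := by
  have h : ∀ i j : Fin m, i ≠ j → ∀ᵐ ω ∂P, U i ω ≠ U j ω := by
    intro i j hij
    have h1 := (indepFun_iff_map_prod_eq_prod_map_map (hU.measurable i).aemeasurable
      (hU.measurable j).aemeasurable).1 (hU.indep.indepFun hij)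
    have hi : P.map (U i) = unif := hU.uniform i
    have hj : P.map (U j) = unif := hU.uniform j
    rw [hi, hj] at h1
    have hms : MeasurableSet {p : ℝ × ℝ | p.1 = p.2} :=
      measurableSet_eq_fun measurable_fst measurable_snd
    have h2 : (unif.prod unif) {p : ℝ × ℝ | p.1 = p.2} = 0 := by
      rw [Measure.measure_prod_null hms]
      refine Eventually.of_forall fun x => ?_
      have : Prod.mk x ⁻¹' {p : ℝ × ℝ | p.1 = p.2} = {x} := by
        ext z; simp [eq_comm]
      change unif _ = 0
      rw [this]
      simp
    rw [← h1, Measure.map_apply ((hU.measurable i).prodMk (hU.measurable j)) hms] at h2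
    rw [ae_iff]
    simpa using h2
  have h' : ∀ᵐ ω ∂P, ∀ i j : Fin m, i ≠ j → U i ω ≠ U j ω := by
    simp only [ae_all_iff]
    exact h
  filter_upwards [h'] with ω hω i j hij
  by_contra hne
  exact hω i j hne hij

/-- Samples of all sizes whose points are distinct, lie in `[-1/2, 1/2]`, and have asymptotically
exponentially distributed spacings. -/
structure IsTypical (u : ∀ m : ℕ, Fin m → ℝ) : Prop where
  injective : ∀ m, Function.Injective (u m)
  mem_box : ∀ m k, u m k ∈ box 1
  tendsto_isolated : ∀ q : ℚ, 0 < q →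
    Tendsto (fun m : ℕ => ((isolated (q / m) (u m)).card : ℝ) / m) atTop (𝓝 (Real.exp (-q)))

theorem ae_isTypical {U : ∀ m : ℕ, Fin m → Ω → ℝ} (hU : ∀ m, IsUniformImpurities P 1 (U m)) :
    ∀ᵐ ω ∂P, IsTypical fun m k => U m k ω := by
  have h1 := ae_all_iff.2 fun m => ae_injective (hU m)
  have h2 := ae_all_iff.2 fun m => ae_mem_box (hU m)
  have h3 : ∀ᵐ ω ∂P, ∀ q : ℚ, 0 < q → Tendsto
      (fun m : ℕ => ((isolated (q / m) fun k => U m k ω).card : ℝ) / m) atTop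
      (𝓝 (Real.exp (-q))) := by
    simp only [ae_all_iff]
    exact fun q hq => ae_tendsto_isolated hU (by exact_mod_cast hq)
  filter_upwards [h1, h2, h3] with ω h1 h2 h3
  exact ⟨h1, h2, h3⟩

end

/-! ### Counting the multiples of `a` below the spacings -/

/-- The number of integers `k ≥ 1` with `k * a < l`. -/
noncomputable def multiplesBelow (a l : ℝ) : ℕ := ⌈l / a⌉₊ - 1

/-- The strict inequality calls for the ceiling minus one rather than the floor; `1 ≤ k` is needed
when the natural subtraction truncates at zero. -/
theorem le_multiplesBelow_iff {a : ℝ} (ha : 0 < a) {l : ℝ} {k : ℕ} (hk : 1 ≤ k) :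
    k ≤ multiplesBelow a l ↔ k * a < l := by
  rw [← lt_div_iff₀ ha, ← Nat.lt_ceil, multiplesBelow]
  omega

theorem multiplesBelow_mul_le {a : ℝ} (ha : 0 < a) {l : ℝ} (hl : 0 ≤ l) :
    multiplesBelow a l * a ≤ l := by
  rcases Nat.eq_zero_or_pos (multiplesBelow a l) with h | h
  · simpa [h] using hl
  · exact ((le_multiplesBelow_iff ha h).1 le_rfl).le

/-- A truncated layer-cake formula: it reduces sums over the intervals to finitely many counts of
intervals longer than `k * a`. -/
theorem min_multiplesBelow {a : ℝ} (ha : 0 < a) (l : ℝ) (K : ℕ) :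
    min K (multiplesBelow a l) = ∑ k ∈ Finset.Icc 1 K, if k * a < l then 1 else 0 := by
  rw [← Finset.card_filter]
  have : (Finset.Icc 1 K).filter (fun k : ℕ => k * a < l) = Finset.Icc 1 (min K (multiplesBelow a l)) := by
    ext k
    simp only [Finset.mem_filter, Finset.mem_Icc, le_min_iff]
    constructor
    · rintro ⟨⟨h1, h2⟩, h3⟩
      exact ⟨h1, h2, (le_multiplesBelow_iff ha h1).2 h3⟩
    · rintro ⟨h1, h2, h3⟩
      exact ⟨⟨h1, h2⟩, (le_multiplesBelow_iff ha h1).1 h3⟩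
  rw [this]
  simp

/-- The multiples of `a` beyond `K * a` are controlled by the excess of `l` over `K * a`, which in
turn is controlled by counting multiples of `a / K`. -/
theorem multiplesBelow_le {a : ℝ} (ha : 0 < a) {l : ℝ} (hl : 0 ≤ l) {K : ℕ} (hK : 0 < K) :
    (multiplesBelow a l : ℝ) ≤ (min K (multiplesBelow a l) : ℕ) +
      (l - a / K * (min (K ^ 2) (multiplesBelow (a / K) l) : ℕ)) / a := by
  have hK' : (0 : ℝ) < K := by exact_mod_cast hK
  have hm := multiplesBelow_mul_le ha hl
  rcases le_total (multiplesBelow a l) K with h | h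
  · rw [min_eq_right h]
    -- The left side is a lower approximation, with mesh `a / K`, of `min l (K * a)`. Here only the
    -- bound by `l` is needed; in the other case it is the bound by `K * a`.
    have h1 : a / K * (min (K ^ 2) (multiplesBelow (a / K) l) : ℕ) ≤ l := by
      calc a / K * (min (K ^ 2) (multiplesBelow (a / K) l) : ℕ)
          ≤ a / K * multiplesBelow (a / K) l := by gcongr; exact min_le_right _ _
        _ = multiplesBelow (a / K) l * (a / K) := mul_comm _ _
        _ ≤ l := multiplesBelow_mul_le (by positivity) hl
    have : 0 ≤ (l - a / K * (min (K ^ 2) (multiplesBelow (a / K) l) : ℕ)) / a :=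
      div_nonneg (by linarith) ha.le
    linarith
  · rw [min_eq_left h]
    have h1 : a / K * (min (K ^ 2) (multiplesBelow (a / K) l) : ℕ) ≤ K * a := by
      calc a / K * (min (K ^ 2) (multiplesBelow (a / K) l) : ℕ)
          ≤ a / K * (K ^ 2 : ℕ) := by gcongr; exact min_le_left _ _
        _ = K * a := by push_cast; field_simp
    have h2 : (multiplesBelow a l : ℝ) ≤ l / a := (le_div_iff₀ ha).2 hm
    have h3 : (l - K * a) / a ≤
        (l - a / K * (min (K ^ 2) (multiplesBelow (a / K) l) : ℕ)) / a := by gcongr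
    have h4 : (l - K * a) / a = l / a - K := by field_simp
    linarith

theorem sum_exp_neg_mul {lam b : ℝ} (h : 0 < lam * b) (n : ℕ) :
    ∑ k ∈ Finset.Icc 1 n, lam * Real.exp (-(lam * (k * b))) =
      lam * (Real.exp (-(lam * b)) / (1 - Real.exp (-(lam * b)))) *
        (1 - Real.exp (-(lam * b)) ^ n) := by
  have hr : Real.exp (-(lam * b)) < 1 := Real.exp_lt_one_iff.2 (by linarith)
  have hr' : 1 - Real.exp (-(lam * b)) ≠ 0 := by linarith
  induction n with
  | zero => simp
  | succ n ih =>
    rw [Finset.sum_Icc_succ_top (by omega), ih]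
    have : Real.exp (-(lam * (((n + 1 : ℕ) : ℝ) * b))) = Real.exp (-(lam * b)) ^ (n + 1) := by
      rw [← Real.exp_nat_mul]
      congr 1
      ring
    rw [this]
    field_simp
    ring

/-- The expression is `x / (eˣ - 1)` at `x = c / K`, the reciprocal of a difference quotient of
`exp` at 0. It says that Riemann sums of the exponential density of refining mesh tend to total mass
1. -/
theorem tendsto_mul_exp_div {c : ℝ} (hc : 0 < c) :
    Tendsto (fun K : ℕ => c / K * (Real.exp (-(c / K)) / (1 - Real.exp (-(c / K))))) atTop
      (𝓝 1) := by
  have h1 : Tendsto (fun x : ℝ => x⁻¹ * (Real.exp x - 1)) (𝓝[≠] 0) (𝓝 1) := by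
    have := (Real.hasDerivAt_exp 0).tendsto_slope_zero
    simpa using this
  have h2 : Tendsto (fun K : ℕ => c / (K : ℝ)) atTop (𝓝[≠] 0) := by
    refine tendsto_nhdsWithin_iff.2 ⟨tendsto_const_div_atTop_nhds_zero_nat c, ?_⟩
    filter_upwards [eventually_gt_atTop 0] with K hK
    have : (0 : ℝ) < K := by exact_mod_cast hK
    exact (div_pos hc this).ne'
  have h3 := (h1.comp h2).inv₀ one_ne_zero
  rw [inv_one] at h3
  refine h3.congr' ?_
  filter_upwards [eventually_gt_atTop 0] with K hK
  have hK' : (0 : ℝ) < K := by exact_mod_cast hK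
  have hx : 0 < c / K := div_pos hc hK'
  simp only [Function.comp]
  generalize c / (K : ℝ) = x at hx
  have he : 1 < Real.exp x := Real.one_lt_exp_iff.2 hx
  have h4 : Real.exp x - 1 ≠ 0 := by linarith
  have h5 : Real.exp (-x) / (1 - Real.exp (-x)) = (Real.exp x - 1)⁻¹ := by
    rw [Real.exp_neg]
    have : Real.exp x ≠ 0 := (Real.exp_pos x).ne'
    field_simp
  rw [h5, mul_inv, inv_inv]

/-- If the numbers of spacings exceeding `t`, per unit length, converge to `λ e^{-λt}` for all `t`,
then so do the numbers of multiples of `a` below the spacings; that the spacings add up to the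
length provides the uniform integrability. -/
theorem tendsto_sum_multiplesBelow {α : Type*} {l : Filter α} {lam a : ℝ} (hlam : 0 < lam)
    (ha : 0 < a) {L : α → ℝ} (hL : ∀ᶠ x in l, 0 < L x) {J : α → ℕ} (gap : ∀ x, Fin (J x) → ℝ)
    (h0 : ∀ᶠ x in l, ∀ j, 0 ≤ gap x j) (hsum : ∀ᶠ x in l, ∑ j, gap x j = L x)
    (hcount : ∀ t : ℝ, 0 < t →
      Tendsto (fun x => (∑ j, if t < gap x j then 1 else 0 : ℝ) / L x) l
        (𝓝 (lam * Real.exp (-(lam * t))))) :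
    Tendsto (fun x => (∑ j, (multiplesBelow a (gap x j) : ℝ)) / L x) l
      (𝓝 (lam * (Real.exp (-(lam * a)) / (1 - Real.exp (-(lam * a)))))) := by
  set c : ℝ → ℕ → α → ℝ := fun b K x =>
    (∑ j, ((min K (multiplesBelow b (gap x j)) : ℕ) : ℝ)) / L x with hc
  set S : ℝ → ℕ → ℝ := fun b K => ∑ k ∈ Finset.Icc 1 K, lam * Real.exp (-(lam * (k * b))) with hS
  set X : α → ℝ := fun x => (∑ j, (multiplesBelow a (gap x j) : ℝ)) / L x with hX
  set R := lam * (Real.exp (-(lam * a)) / (1 - Real.exp (-(lam * a)))) with hR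
  have hcS : ∀ b : ℝ, 0 < b → ∀ K, Tendsto (c b K) l (𝓝 (S b K)) := by
    intro b hb K
    have h1 : Tendsto (fun x => ∑ k ∈ Finset.Icc 1 K,
        (∑ j, if k * b < gap x j then 1 else 0 : ℝ) / L x) l (𝓝 (S b K)) := by
      refine tendsto_finsetSum _ fun k hk => hcount (k * b) ?_
      have : (1 : ℝ) ≤ k := by exact_mod_cast (Finset.mem_Icc.1 hk).1
      positivity
    refine h1.congr fun x => ?_
    rw [hc]
    simp only
    rw [← Finset.sum_div, Finset.sum_comm]
    congr 1
    refine Finset.sum_congr rfl fun j _ => ?_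
    rw [min_multiplesBelow hb]
    push_cast
    rfl
  have hlow : ∀ K, ∀ᶠ x in l, c a K x ≤ X x := by
    intro K
    filter_upwards [hL] with x hx
    simp only [hc, hX]
    gcongr
    exact min_le_right _ _
  -- The `1` is the total length divided by `L`; what is subtracted is the length visible in
  -- intervals truncated at `K * a`.
  have hup : ∀ K : ℕ, 0 < K → ∀ᶠ x in l,
      X x ≤ c a K x + (1 - a / K * c (a / K) (K ^ 2) x) / a := by
    intro K hK
    filter_upwards [hL, h0, hsum] with x hx h0 hsum
    have h1 := Finset.sum_le_sum fun j (_ : j ∈ Finset.univ) => multiplesBelow_le ha (h0 j) hK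
    rw [Finset.sum_add_distrib, ← Finset.sum_div, Finset.sum_sub_distrib, ← Finset.mul_sum,
      hsum] at h1
    simp only [hc, hX]
    rw [div_le_iff₀ hx]
    refine h1.trans_eq ?_
    field_simp
  have hSR : Tendsto (fun K => S a K) atTop (𝓝 R) := by
    have hr : Real.exp (-(lam * a)) < 1 :=
      Real.exp_lt_one_iff.2 (by have := mul_pos hlam ha; linarith)
    have h1 := (tendsto_pow_atTop_nhds_zero_of_lt_one (Real.exp_pos _).le hr).const_sub 1
    have h2 := h1.const_mul R
    rw [sub_zero, mul_one] at h2
    refine h2.congr fun K => ?_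
    rw [hS]
    simp only
    rw [sum_exp_neg_mul (mul_pos hlam ha)]
  -- `K ^ 2` steps of mesh `a / K` reach up to `K * a`, so mesh and cutoff are removed together and
  -- no length is lost in the limit.
  have hD : Tendsto (fun K : ℕ => (1 - a / K * S (a / K) (K ^ 2)) / a) atTop (𝓝 0) := by
    have h1 := tendsto_mul_exp_div (mul_pos hlam ha)
    have hr : Real.exp (-(lam * a)) < 1 :=
      Real.exp_lt_one_iff.2 (by have := mul_pos hlam ha; linarith)
    have h2 := (tendsto_pow_atTop_nhds_zero_of_lt_one (Real.exp_pos _).le hr).const_sub 1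
    have h3 := ((h1.mul h2).const_sub 1).div_const a
    rw [sub_zero, mul_one, sub_self, zero_div] at h3
    refine h3.congr' ?_
    filter_upwards [eventually_gt_atTop 0] with K hK
    have hK' : (0 : ℝ) < K := by exact_mod_cast hK
    rw [hS]
    simp only
    rw [sum_exp_neg_mul (by positivity)]
    have h4 : Real.exp (-(lam * (a / K))) ^ (K ^ 2) = Real.exp (-(lam * a)) ^ K := by
      rw [← Real.exp_nat_mul, ← Real.exp_nat_mul]
      congr 1
      push_cast
      field_simp
    rw [h4, mul_div_assoc lam a]
    ring
  -- In both bounds `K` is fixed first, and only then the limit along `l` is taken.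
  refine tendsto_order.2 ⟨fun b hb => ?_, fun b hb => ?_⟩
  · obtain ⟨K, hK⟩ := ((tendsto_order.1 hSR).1 b hb).exists
    filter_upwards [(tendsto_order.1 (hcS a ha K)).1 b hK, hlow K] with x h1 h2
    exact h1.trans_le h2
  · have h1 := hSR.add hD
    rw [add_zero] at h1
    obtain ⟨K, hK, hK0⟩ := (((tendsto_order.1 h1).2 b hb).and (eventually_gt_atTop 0)).exists
    have hK' : (0 : ℝ) < K := by exact_mod_cast hK0
    have h2 := (hcS a ha K).add
      ((((hcS (a / K) (by positivity) (K ^ 2)).const_mul (a / K)).const_sub 1).div_const a)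
    filter_upwards [(tendsto_order.1 h2).2 b hK, hup K hK0] with x h3 h4
    exact h4.trans_lt h3

/-! ### Spacings of the nodes -/

/-- The lengths of the intervals between consecutive nodes. -/
noncomputable def spacing (L : ℝ) {m : ℕ} (y : Fin m → ℝ) (j : Fin (m + 1)) : ℝ :=
  nodes L y j.succ - nodes L y j.castSucc

theorem nodes_castSucc_zero (L : ℝ) {m : ℕ} (y : Fin m → ℝ) :
    nodes L y (Fin.castSucc 0) = -(L / 2) := rfl

theorem nodes_castSucc_succ (L : ℝ) {m : ℕ} (y : Fin m → ℝ) (k : Fin m) :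
    nodes L y k.succ.castSucc = y (Tuple.sort y k) := by
  rw [nodes, ← Fin.succ_castSucc, Fin.cons_succ, Fin.snoc_castSucc]
  rfl

theorem nodes_succ_castSucc (L : ℝ) {m : ℕ} (y : Fin m → ℝ) (k : Fin m) :
    nodes L y k.castSucc.succ = y (Tuple.sort y k) := by
  rw [Fin.succ_castSucc, nodes_castSucc_succ]

theorem nodes_succ_last (L : ℝ) {m : ℕ} (y : Fin m → ℝ) :
    nodes L y (Fin.last m).succ = L / 2 := by
  rw [nodes, Fin.cons_succ, Fin.snoc_last]

theorem sum_spacing (L : ℝ) {m : ℕ} (y : Fin m → ℝ) : ∑ j, spacing L y j = L := by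
  simp only [spacing, Finset.sum_sub_distrib]
  rw [Fin.sum_univ_castSucc, Fin.sum_univ_succ fun j => nodes L y j.castSucc]
  simp only [nodes_succ_castSucc, nodes_succ_last, nodes_castSucc_succ, nodes_castSucc_zero]
  ring

theorem spacing_nonneg {L : ℝ} (hL : 0 ≤ L) {m : ℕ} {y : Fin m → ℝ} (hy : ∀ k, y k ∈ box L)
    (j : Fin (m + 1)) : 0 ≤ spacing L y j := by
  rw [spacing, sub_nonneg]
  refine Fin.lastCases ?_ (fun k => ?_) j
  · rw [nodes_succ_last]
    refine Fin.cases ?_ (fun k => ?_) (Fin.last m)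
    · rw [nodes_castSucc_zero]; linarith
    · rw [nodes_castSucc_succ]; exact (hy _).2
  · rw [nodes_succ_castSucc]
    obtain h | ⟨i, hi⟩ := Fin.eq_zero_or_eq_succ k.castSucc
    · rw [h, nodes_castSucc_zero]; exact (hy _).1
    · rw [hi, nodes_castSucc_succ]
      refine Tuple.monotone_sort y ?_
      have := congrArg Fin.val hi
      simp only [Fin.val_castSucc, Fin.val_succ] at this
      rw [Fin.le_def]
      omega

/-- The interval `k.succ` starts at the `k`-th smallest impurity and ends at the next one, or at
`L/2` if there is none; the two clauses of `isolated` cover these two kinds of right end point. -/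
theorem lt_spacing_succ_iff {L : ℝ} (hL : 0 < L) {m : ℕ} {u : Fin m → ℝ}
    (hinj : Function.Injective u) (hu : ∀ k, u k ∈ box 1) {t : ℝ} (k : Fin m) :
    t < spacing L (fun k => L * u k) k.succ ↔
      Tuple.sort (fun k => L * u k) k ∈ isolated (t / L) u := by
  set y : Fin m → ℝ := fun k => L * u k with hy
  set σ := Tuple.sort y with hσ
  have hmono : Monotone (y ∘ σ) := Tuple.monotone_sort y
  have hyinj : Function.Injective y := fun i j h => hinj (mul_left_cancel₀ hL.ne' h)
  have hybox : ∀ i, y i ≤ L / 2 := fun i => by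
    have := (hu i).2
    calc L * u i ≤ L * (1 / 2) := by gcongr
      _ = L / 2 := by ring
  have hiso : σ k ∈ isolated (t / L) u ↔ y (σ k) + t < L / 2 ∧
      ∀ i, i ≠ σ k → y i ∉ Icc (y (σ k)) (y (σ k) + t) := by
    rw [mem_isolated]
    have e : ∀ i, u i = y i / L := fun i => by rw [hy]; field_simp
    refine and_congr ?_ (forall_congr' fun i => imp_congr_right fun _ => not_congr ?_)
    · rw [e, ← add_div, div_lt_iff₀ hL, one_div_mul_eq_div]
    · rw [e, e, ← add_div, mem_Icc, mem_Icc, div_le_div_iff_of_pos_right hL,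
        div_le_div_iff_of_pos_right hL]
  rw [hiso, spacing, nodes_castSucc_succ, lt_sub_iff_add_lt']
  constructor
  · intro h
    constructor
    · refine h.trans_le ?_
      refine Fin.lastCases ?_ (fun i => ?_) k.succ
      · rw [nodes_succ_last]
      · rw [nodes_succ_castSucc]; exact hybox _
    · rintro i hi ⟨h1, h2⟩
      obtain ⟨i', rfl⟩ := σ.surjective i
      have hne : i' ≠ k := fun h => hi (h ▸ rfl)
      rcases lt_or_gt_of_ne hne with hlt | hgt
      · exact hi (hyinj (le_antisymm (hmono hlt.le) h1))
      · have h3 : nodes L y k.succ.succ ≤ y (σ i') := by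
          obtain ⟨k', hk'⟩ | h := Fin.eq_castSucc_or_eq_last k.succ
          · rw [hk', nodes_succ_castSucc]
            refine hmono ?_
            have := congrArg Fin.val hk'
            simp only [Fin.val_castSucc, Fin.val_succ] at this
            rw [Fin.lt_def] at hgt
            rw [Fin.le_def]
            omega
          · have := congrArg Fin.val h
            simp only [Fin.val_last, Fin.val_succ] at this
            have := i'.2
            rw [Fin.lt_def] at hgt
            omega
        linarith
  · rintro ⟨h1, h2⟩
    obtain ⟨k', hk'⟩ | h := Fin.eq_castSucc_or_eq_last k.succ
    · rw [hk', nodes_succ_castSucc]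
      have hv := congrArg Fin.val hk'
      simp only [Fin.val_castSucc, Fin.val_succ] at hv
      have hlt : k < k' := by rw [Fin.lt_def]; omega
      by_contra hcon
      exact h2 (σ k') (fun h => hlt.ne' (σ.injective h)) ⟨hmono hlt.le, not_lt.1 hcon⟩
    · rwa [h, nodes_succ_last]

/-- The first interval starts at `-L/2` and not at an impurity, hence the separate term, which is
negligible after division by `L`. The others are reindexed by the sorting permutation. -/
theorem sum_lt_spacing {L : ℝ} (hL : 0 < L) {m : ℕ} {u : Fin m → ℝ}
    (hinj : Function.Injective u) (hu : ∀ k, u k ∈ box 1) (t : ℝ) :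
    (∑ j, if t < spacing L (fun k => L * u k) j then 1 else 0 : ℝ) =
      (if t < spacing L (fun k => L * u k) 0 then 1 else 0) + (isolated (t / L) u).card := by
  classical
  rw [Fin.sum_univ_succ]
  congr 1
  simp_rw [lt_spacing_succ_iff hL hinj hu]
  rw [Equiv.sum_comp (Tuple.sort fun k => L * u k)
    (fun i => if i ∈ isolated (t / L) u then (1 : ℝ) else 0)]
  simp

/-- Squeeze between rational windows on either side of `σ`, using `isolated_anti` and continuity of
`exp`. The window must be allowed to vary because `m / L` is only asymptotically constant. -/
theorem IsTypical.tendsto {u : ∀ m : ℕ, Fin m → ℝ} (hu : IsTypical u) {α : Type*} {l : Filter α}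
    {m : α → ℕ} (hm : Tendsto m l atTop) {s : α → ℝ} {σ : ℝ} (hσ : 0 < σ)
    (hs : Tendsto s l (𝓝 σ)) :
    Tendsto (fun x => ((isolated (s x / m x) (u (m x))).card : ℝ) / m x) l
      (𝓝 (Real.exp (-σ))) := by
  have hcont : Continuous fun q : ℝ => Real.exp (-q) := by fun_prop
  refine tendsto_order.2 ⟨fun b hb => ?_, fun b hb => ?_⟩
  · obtain ⟨ε, hε, hball⟩ := Metric.eventually_nhds_iff.1
      ((tendsto_order.1 (hcont.tendsto σ)).1 b hb)
    obtain ⟨q, hq1, hq2⟩ := exists_rat_btwn (lt_add_of_pos_right σ hε)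
    have hbq : b < Real.exp (-q) := hball (by
      rw [Real.dist_eq, abs_lt]; constructor <;> linarith)
    have hq0 : (0 : ℚ) < q := by
      have : (0 : ℝ) < q := hσ.trans hq1
      exact_mod_cast this
    filter_upwards [hm.eventually ((tendsto_order.1 (hu.tendsto_isolated q hq0)).1 b hbq),
      (tendsto_order.1 hs).2 _ hq1] with x h1 h2
    refine h1.trans_le ?_
    gcongr
    exact isolated_anti (by gcongr) _
  · obtain ⟨ε, hε, hball⟩ := Metric.eventually_nhds_iff.1
      ((tendsto_order.1 (hcont.tendsto σ)).2 b hb)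
    obtain ⟨q, hq1, hq2⟩ := exists_rat_btwn
      (show max 0 (σ - ε) < σ from max_lt hσ (by linarith))
    have hq1' := max_lt_iff.1 hq1
    have hbq : Real.exp (-q) < b := hball (by
      rw [Real.dist_eq, abs_lt]; constructor <;> linarith [hq1'.2])
    have hq0 : (0 : ℚ) < q := by exact_mod_cast hq1'.1
    filter_upwards [hm.eventually ((tendsto_order.1 (hu.tendsto_isolated q hq0)).2 b hbq),
      (tendsto_order.1 hs).1 _ hq2] with x h1 h2
    refine lt_of_le_of_lt ?_ h1
    gcongr
    exact isolated_anti (by gcongr) _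

theorem IsTypical.tendsto_sum_multiplesBelow {u : ∀ m : ℕ, Fin m → ℝ} (hu : IsTypical u)
    {α : Type*} {l : Filter α} {m : α → ℕ} {L : α → ℝ} (hL : Tendsto L l atTop) {lam : ℝ}
    (hlam : 0 < lam) (hmL : Tendsto (fun x => ((m x : ℝ) + 1) / L x) l (𝓝 lam)) {a : ℝ}
    (ha : 0 < a) :
    Tendsto (fun x => (∑ j, (multiplesBelow a
        (spacing (L x) (fun k => L x * u (m x) k) j) : ℝ)) / L x) l
      (𝓝 (lam * (Real.exp (-(lam * a)) / (1 - Real.exp (-(lam * a)))))) := by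
  have hL0 : ∀ᶠ x in l, 0 < L x := hL.eventually_gt_atTop 0
  have hinv : Tendsto (fun x => 1 / L x) l (𝓝 0) := by
    simp only [one_div]
    exact hL.inv_tendsto_atTop
  have hmL' : Tendsto (fun x => (m x : ℝ) / L x) l (𝓝 lam) := by
    have := hmL.sub hinv
    rw [sub_zero] at this
    refine this.congr fun x => ?_
    rw [← sub_div, add_sub_cancel_right]
  have hm : Tendsto m l atTop := by
    rw [← tendsto_natCast_atTop_iff (R := ℝ)]
    refine (hmL'.pos_mul_atTop hlam hL).congr' ?_
    filter_upwards [hL0] with x hx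
    exact div_mul_cancel₀ _ hx.ne'
  refine LuttingerSy.tendsto_sum_multiplesBelow hlam ha hL0
    (fun x => spacing (L x) (fun k => L x * u (m x) k)) ?_
    (Eventually.of_forall fun x => sum_spacing _ _) ?_
  · filter_upwards [hL0] with x hx
    refine spacing_nonneg hx.le fun k => ?_
    obtain ⟨h1, h2⟩ := hu.mem_box (m x) k
    constructor
    · calc -(L x / 2) = L x * -(1 / 2) := by ring
        _ ≤ L x * u (m x) k := by gcongr
    · calc L x * u (m x) k ≤ L x * (1 / 2) := by gcongr
        _ = L x / 2 := by ring
  · intro t ht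
    -- A length `t` in the box of size `L` is the rescaled window `t / L = (t m / L) / m`.
    have hs : Tendsto (fun x => t * ((m x : ℝ) / L x)) l (𝓝 (t * lam)) := hmL'.const_mul t
    have h1 := (hu.tendsto hm (mul_pos ht hlam) hs).mul hmL'
    have h2 : Tendsto (fun x => (if t < spacing (L x) (fun k => L x * u (m x) k) 0
        then (1 : ℝ) else 0) / L x) l (𝓝 0) := by
      refine squeeze_zero' ?_ ?_ hinv
      · filter_upwards [hL0] with x hx
        split_ifs <;> positivity
      · filter_upwards [hL0] with x hx
        gcongr
        split_ifs <;> norm_num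
    have h3 := h2.add h1
    rw [zero_add, mul_comm, mul_comm t lam] at h3
    refine h3.congr' ?_
    filter_upwards [hL0, hm.eventually_gt_atTop 0] with x hx hmx
    have hmx' : (0 : ℝ) < m x := by exact_mod_cast hmx
    rw [sum_lt_spacing hx (hu.injective _) (hu.mem_box _), add_div,
      show t * ((m x : ℝ) / L x) / m x = t / L x by field_simp, div_mul_div_cancel₀ hmx'.ne']

/-! ### Weak derivatives on an interval -/

theorem memLp_of_continuous (a b : ℝ) {u : ℝ → ℂ} (hu : Continuous u) :
    MemLp u 2 (volume.restrict (Ioo a b)) := by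
  obtain ⟨C, hC⟩ := (isCompact_Icc (a := a) (b := b)).exists_bound_of_continuousOn hu.continuousOn
  refine MemLp.of_bound hu.aestronglyMeasurable C ?_
  filter_upwards [ae_restrict_mem measurableSet_Ioo] with x hx
  exact hC x (Ioo_subset_Icc_self hx)

/-- A continuous function as an element of `L²((a,b))`. -/
noncomputable def contLp (a b : ℝ) (u : ℝ → ℂ) (hu : Continuous u) : L2 a b :=
  (memLp_of_continuous a b hu).toLp u

theorem coeFn_contLp (a b : ℝ) {u : ℝ → ℂ} (hu : Continuous u) :
    contLp a b u hu =ᵐ[volume.restrict (Ioo a b)] u :=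
  (memLp_of_continuous a b hu).coeFn_toLp

theorem IsTestFunction.eq_zero {a b : ℝ} {φ : ℝ → ℝ} (h : IsTestFunction a b φ) {x : ℝ}
    (hx : x ∉ Ioo a b) : φ x = 0 :=
  image_eq_zero_of_notMem_tsupport fun hx' => hx (h.2.2 hx')

theorem IsTestFunction.hasDerivAt {a b : ℝ} {φ : ℝ → ℝ} (h : IsTestFunction a b φ) (x : ℝ) :
    HasDerivAt φ (deriv φ x) x :=
  (h.1.differentiable (by simp)).differentiableAt.hasDerivAt

theorem IsTestFunction.continuous_deriv {a b : ℝ} {φ : ℝ → ℝ} (h : IsTestFunction a b φ) :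
    Continuous (deriv φ) :=
  h.1.continuous_deriv (by simp)

theorem setIntegral_Ioo_eq_intervalIntegral {a b : ℝ} (hab : a ≤ b) (f : ℝ → ℂ) :
    ∫ x in Ioo a b, f x = ∫ x in a..b, f x := by
  rw [intervalIntegral.integral_of_le hab, integral_Ioc_eq_integral_Ioo]

theorem hasWeakDeriv_contLp {a b : ℝ} {u u' : ℝ → ℂ} (hu : Continuous u) (hu' : Continuous u')
    (h : ∀ x, HasDerivAt u (u' x) x) : HasWeakDeriv (contLp a b u hu) (contLp a b u' hu') := by
  intro φ hφ
  have h1 : ∫ x in Ioo a b, deriv φ x • contLp a b u hu x = ∫ x in Ioo a b, deriv φ x • u x := by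
    refine integral_congr_ae ?_
    filter_upwards [coeFn_contLp a b hu] with x hx
    rw [hx]
  have h2 : ∫ x in Ioo a b, φ x • contLp a b u' hu' x = ∫ x in Ioo a b, φ x • u' x := by
    refine integral_congr_ae ?_
    filter_upwards [coeFn_contLp a b hu'] with x hx
    rw [hx]
  rw [h1, h2]
  rcases le_or_gt b a with hab | hab
  · simp [Ioo_eq_empty (not_lt.2 hab)]
  rw [setIntegral_Ioo_eq_intervalIntegral hab.le, setIntegral_Ioo_eq_intervalIntegral hab.le]
  have hc1 : Continuous fun x => deriv φ x • u x := hφ.continuous_deriv.smul hu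
  have hc2 : Continuous fun x => φ x • u' x := hφ.1.continuous.smul hu'
  have h3 := intervalIntegral.integral_eq_sub_of_hasDerivAt (a := a) (b := b)
    (f := fun x => φ x • u x) (f' := fun x => φ x • u' x + deriv φ x • u x)
    (fun x _ => (hφ.hasDerivAt x).smul (h x)) ((hc2.add hc1).intervalIntegrable _ _)
  rw [intervalIntegral.integral_add (hc2.intervalIntegrable _ _) (hc1.intervalIntegrable _ _),
    hφ.eq_zero (x := a) (by simp), hφ.eq_zero (x := b) (by simp)] at h3
  simp only [zero_smul, sub_zero] at h3
  rw [eq_neg_iff_add_eq_zero, add_comm]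
  exact h3

theorem L2.integrable {a b : ℝ} (h : L2 a b) : Integrable h (volume.restrict (Ioo a b)) :=
  (Lp.memLp h).integrable (by norm_num)

theorem L2.intervalIntegrable {a b : ℝ} (hab : a ≤ b) (h : L2 a b) :
    IntervalIntegrable h volume a b := by
  rw [intervalIntegrable_iff_integrableOn_Ioo_of_le hab]
  exact h.integrable

/-- Integration by parts against the primitive of an `L²` function. -/
theorem integral_deriv_smul_primitive {a b : ℝ} (h : L2 a b) {φ : ℝ → ℝ}
    (hφ : IsTestFunction a b φ) :
    ∫ x in Ioo a b, deriv φ x • (∫ y in a..x, h y) = -∫ x in Ioo a b, φ x • h x := by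
  set ν := volume.restrict (Ioo a b) with hν
  -- Fubini on the triangle `y ≤ x`: integrating `φ'` over `[y, b]` leaves `-φ y`.
  set D : Set (ℝ × ℝ) := {p | p.2 ≤ p.1} with hD
  have hDm : MeasurableSet D := measurableSet_le measurable_snd measurable_fst
  have hφi : Integrable (fun x => deriv φ x) ν :=
    (hφ.continuous_deriv.integrableOn_Icc (a := a) (b := b)).mono_set Ioo_subset_Icc_self
  have hint : Integrable (fun p : ℝ × ℝ => D.indicator (fun p => deriv φ p.1 • h p.2) p)
      (ν.prod ν) := (Integrable.smul_prod hφi h.integrable).indicator hDm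
  have hL : ∫ x in Ioo a b, deriv φ x • (∫ y in a..x, h y) =
      ∫ x, ∫ y, D.indicator (fun p => deriv φ p.1 • h p.2) (x, y) ∂ν ∂ν := by
    refine setIntegral_congr_fun measurableSet_Ioo fun x hx => ?_
    rw [intervalIntegral.integral_of_le hx.1.le, ← integral_smul]
    have h1 : (fun y => D.indicator (fun p : ℝ × ℝ => deriv φ p.1 • h p.2) (x, y)) =
        (Iic x).indicator fun y => deriv φ x • h y := by
      funext y
      simp [indicator_apply, hD]
    rw [h1, integral_indicator measurableSet_Iic, hν, Measure.restrict_restrict measurableSet_Iic]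
    congr 2
    ext y
    simp only [mem_Ioc, mem_inter_iff, mem_Iic, mem_Ioo]
    exact ⟨fun h => ⟨h.2, h.1, h.2.trans_lt hx.2⟩, fun h => ⟨h.2.1, h.1⟩⟩
  have hR : ∫ y, ∫ x, D.indicator (fun p => deriv φ p.1 • h p.2) (x, y) ∂ν ∂ν =
      ∫ y in Ioo a b, -(φ y • h y) := by
    refine setIntegral_congr_fun measurableSet_Ioo fun y hy => ?_
    have h1 : (fun x => D.indicator (fun p : ℝ × ℝ => deriv φ p.1 • h p.2) (x, y)) =
        (Ici y).indicator fun x => deriv φ x • h y := by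
      funext x
      simp [indicator_apply, hD]
    rw [h1, integral_indicator measurableSet_Ici, hν, Measure.restrict_restrict measurableSet_Ici,
      integral_smul_const]
    have h2 : Ici y ∩ Ioo a b = Ico y b := by
      ext x
      simp only [mem_Ico, mem_inter_iff, mem_Ici, mem_Ioo]
      exact ⟨fun h => ⟨h.1, h.2.2⟩, fun h => ⟨h.1, hy.1.trans_le h.1, h.2⟩⟩
    rw [h2, integral_Ico_eq_integral_Ioc, ← intervalIntegral.integral_of_le hy.2.le,
      intervalIntegral.integral_eq_sub_of_hasDerivAt (fun x _ => hφ.hasDerivAt x)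
        (hφ.continuous_deriv.intervalIntegrable _ _), hφ.eq_zero (x := b) (by simp), zero_sub,
      neg_smul]
  rw [hL, integral_integral_swap hint, hR, integral_neg]

/-- A test function of integral zero is the derivative of a test function. -/
theorem IsTestFunction.exists_deriv_eq {a b : ℝ} (hab : a < b) {η : ℝ → ℝ}
    (hη : IsTestFunction a b η) (h0 : ∫ x in a..b, η x = 0) :
    ∃ Φ, IsTestFunction a b Φ ∧ deriv Φ = η := by
  set Φ : ℝ → ℝ := fun x => ∫ y in a..x, η y with hΦ
  have hder : ∀ x, HasDerivAt Φ (η x) x := fun x =>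
    intervalIntegral.integral_hasDerivAt_right (hη.1.continuous.intervalIntegrable _ _)
      (hη.1.continuous.stronglyMeasurableAtFilter _ _) hη.1.continuous.continuousAt
  have hderiv : deriv Φ = η := funext fun x => (hder x).deriv
  obtain ⟨α, β, hα, hβ, hsub⟩ : ∃ α β, a < α ∧ β < b ∧ tsupport η ⊆ Icc α β := by
    rcases (tsupport η).eq_empty_or_nonempty with he | hne
    -- For empty support the reversed pair makes `Icc α β` empty.
    · exact ⟨b, a, hab, hab, by simp [he]⟩
    · have hc : IsCompact (tsupport η) := hη.2.1
      obtain ⟨α, hα⟩ := hc.exists_isLeast hne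
      obtain ⟨β, hβ⟩ := hc.exists_isGreatest hne
      exact ⟨α, β, (hη.2.2 hα.1).1, (hη.2.2 hβ.1).2, fun x hx => ⟨hα.2 hx, hβ.2 hx⟩⟩
  have hz : ∀ x, x ∉ Icc α β → η x = 0 := fun x hx =>
    image_eq_zero_of_notMem_tsupport fun hx' => hx (hsub hx')
  have hsupp : Function.support Φ ⊆ Icc α β := by
    intro x hx
    by_contra hxI
    refine hx ?_
    rcases lt_or_ge x α with hxα | hxα
    · refine (intervalIntegral.integral_congr (g := fun _ => 0) fun y hy => ?_).trans (by simp)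
      refine hz y fun hy' => ?_
      have : y ≤ max a x := hy.2
      exact absurd hy'.1 (not_le.2 (this.trans_lt (max_lt hα hxα)))
    · have hxβ : β < x := not_le.1 fun h => hxI ⟨hxα, h⟩
      have h1 : ∫ y in x..b, η y = 0 := by
        refine (intervalIntegral.integral_congr (g := fun _ => 0) fun y hy => ?_).trans (by simp)
        refine hz y fun hy' => ?_
        have : min x b ≤ y := hy.1
        exact absurd hy'.2 (not_le.2 ((lt_min hxβ hβ).trans_le this))
      have h2 := intervalIntegral.integral_add_adjacent_intervals
        (hη.1.continuous.intervalIntegrable (μ := volume) a x)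
        (hη.1.continuous.intervalIntegrable (μ := volume) x b)
      rw [h1, h0, add_zero] at h2
      exact h2
  have hts : tsupport Φ ⊆ Icc α β := closure_minimal hsupp isClosed_Icc
  refine ⟨Φ, ⟨?_, ?_, ?_⟩, hderiv⟩
  · rw [contDiff_infty_iff_deriv, hderiv]
    exact ⟨fun x => (hder x).differentiableAt, hη.1⟩
  · exact isCompact_Icc.of_isClosed_subset (isClosed_tsupport _) hts
  · exact hts.trans fun x hx => ⟨hα.trans_le hx.1, hx.2.trans_lt hβ⟩

theorem exists_isTestFunction {a b : ℝ} (hab : a < b) :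
    ∃ ψ, IsTestFunction a b ψ ∧ ∫ x in a..b, ψ x = 1 := by
  let B : ContDiffBump ((a + b) / 2) :=
    ⟨(b - a) / 8, (b - a) / 4, by linarith, by linarith⟩
  have hsub : tsupport (B.normed volume) ⊆ Ioo a b := by
    rw [B.tsupport_normed_eq, Real.closedBall_eq_Icc]
    intro x hx
    have h1 : (a + b) / 2 - (b - a) / 4 ≤ x := hx.1
    have h2 : x ≤ (a + b) / 2 + (b - a) / 4 := hx.2
    constructor <;> linarith
  refine ⟨B.normed volume, ⟨B.contDiff_normed, B.hasCompactSupport_normed, hsub⟩, ?_⟩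
  rw [intervalIntegral.integral_of_le hab.le, setIntegral_eq_integral_of_forall_compl_eq_zero,
    B.integral_normed]
  intro x hx
  exact image_eq_zero_of_notMem_tsupport fun hx' => hx (Ioo_subset_Ioc_self (hsub hx'))

/-- **Du Bois-Reymond lemma**: an `L²` function with a weak derivative is a.e. equal to a primitive
of that derivative. -/
theorem HasWeakDeriv.exists_ae_eq {a b : ℝ} (hab : a < b) {g h : L2 a b} (hgh : HasWeakDeriv g h) :
    ∃ C : ℂ, g =ᵐ[volume.restrict (Ioo a b)] fun x => C + ∫ y in a..x, h y := by
  set ν := volume.restrict (Ioo a b) with hν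
  obtain ⟨ψ, hψ, hψ1⟩ := exists_isTestFunction hab
  set H : ℝ → ℂ := fun x => ∫ y in a..x, h y with hH
  have hHc : ContinuousOn H (Icc a b) :=
    intervalIntegral.continuousOn_primitive_interval' (h.intervalIntegrable hab.le) left_mem_uIcc
      |>.mono (by rw [uIcc_of_le hab.le])
  have hHi : Integrable H ν := (hHc.integrableOn_Icc).mono_set Ioo_subset_Icc_self
  -- `w` has weak derivative zero and must be shown constant; the constant is its mean against `ψ`.
  set w : ℝ → ℂ := fun x => g x - H x with hw
  have hwi : Integrable w ν := g.integrable.sub hHi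
  have smul_int : ∀ {φ : ℝ → ℝ} {f : ℝ → ℂ}, Continuous φ → HasCompactSupport φ → Integrable f ν →
      Integrable (fun x => φ x • f x) ν := by
    intro φ f hc hs hf
    obtain ⟨C, hC⟩ := hc.bounded_above_of_compact_support hs
    exact hf.bdd_smul C hc.aestronglyMeasurable (Eventually.of_forall hC)
  have hw0 : ∀ Φ, IsTestFunction a b Φ → ∫ x, deriv Φ x • w x ∂ν = 0 := by
    intro Φ hΦ
    have e : ∀ x, deriv Φ x • w x = deriv Φ x • g x - deriv Φ x • H x := fun x => smul_sub _ _ _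
    simp_rw [e]
    rw [integral_sub (hΦ.integrable_deriv g) (smul_int hΦ.continuous_deriv hΦ.2.1.deriv hHi),
      hgh Φ hΦ, integral_deriv_smul_primitive h hΦ, sub_self]
  set C : ℂ := ∫ x, ψ x • w x ∂ν with hC
  refine ⟨C, ?_⟩
  have hconst : IntegrableOn (fun x => w x - C) (Ioo a b) volume := hwi.sub (integrable_const C)
  have key := isOpen_Ioo.ae_eq_zero_of_integral_contDiff_smul_eq_zero (μ := volume)
    (f := fun x => w x - C) (U := Ioo a b) hconst.locallyIntegrableOn (by
      intro φ h1 h2 h3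
      have hφ : IsTestFunction a b φ := ⟨h1, h2, h3⟩
      set I : ℝ := ∫ x in a..b, φ x with hI
      -- Subtracting `I * ψ` makes the integral zero, so this is the derivative of a test function
      -- and `w` annihilates it.
      have hηt : IsTestFunction a b (fun x => φ x - I * ψ x) := by
        refine ⟨h1.sub (contDiff_const.mul hψ.1), h2.sub hψ.2.1.mul_left, ?_⟩
        refine (tsupport_sub φ fun x => I * ψ x).trans (union_subset h3 ?_)
        exact (tsupport_mul_subset_right).trans hψ.2.2
      obtain ⟨Φ, hΦ, hΦd⟩ := hηt.exists_deriv_eq hab (by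
        rw [intervalIntegral.integral_sub (h1.continuous.intervalIntegrable _ _)
          ((hψ.1.continuous.const_mul I).intervalIntegrable _ _),
          intervalIntegral.integral_const_mul, hψ1, mul_one, sub_self])
      have h4 := hw0 Φ hΦ
      rw [hΦd] at h4
      have e : ∀ x, (φ x - I * ψ x) • w x = φ x • w x - I • ψ x • w x := fun x => by
        rw [sub_smul, mul_smul]
      simp_rw [e] at h4
      have hψw : Integrable (fun x => I • ψ x • w x) ν :=
        (smul_int hψ.1.continuous hψ.2.1 hwi).smul I
      rw [integral_sub (smul_int h1.continuous h2 hwi) hψw, integral_smul, ← hC, sub_eq_zero] at h4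
      rw [← setIntegral_eq_integral_of_forall_compl_eq_zero (s := Ioo a b)]
      · simp_rw [smul_sub]
        rw [integral_sub (smul_int h1.continuous h2 hwi)
          (smul_int h1.continuous h2 (integrable_const C)), h4, integral_smul_const, sub_eq_zero]
        congr 1
        rw [hI, intervalIntegral.integral_of_le hab.le, integral_Ioc_eq_integral_Ioo]
      · intro x hx
        rw [hφ.eq_zero hx, zero_smul])
  filter_upwards [(ae_restrict_iff' measurableSet_Ioo).2 key] with x hx
  simp only [hw] at hx
  linear_combination hx

/-! ### Eigenfunctions of the Dirichlet operator -/

theorem constOn_of_hasDerivAt_zero {a b : ℝ} {w : ℝ → ℂ} (h : ∀ x ∈ Icc a b, HasDerivAt w 0 x) :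
    ∀ x ∈ Icc a b, w x = w a :=
  constant_of_has_deriv_right_zero (fun x hx => (h x hx).continuousAt.continuousWithinAt)
    fun x hx => (h x (Ico_subset_Icc_self hx)).hasDerivWithinAt

/-- Solutions of `u'' = -κ² u` with `u(a) = 0` are multiples of `sin (κ (x - a))`. -/
theorem mul_eq_sin_of_hasDerivAt {a b : ℝ} {κ : ℂ} {u v : ℝ → ℂ}
    (hu : ∀ x ∈ Icc a b, HasDerivAt u (v x) x)
    (hv : ∀ x ∈ Icc a b, HasDerivAt v (-κ ^ 2 * u x) x) (ha : u a = 0) :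
    ∀ x ∈ Icc a b, κ * u x = v a * Complex.sin (κ * (x - a)) := by
  have hlin : ∀ x : ℝ, HasDerivAt (fun x : ℝ => κ * ((x : ℂ) - a)) κ x := fun x => by
    simpa using ((Complex.ofRealCLM.hasDerivAt (x := x)).sub_const (a : ℂ)).const_mul κ
  have hsin : ∀ x : ℝ, HasDerivAt (fun x : ℝ => Complex.sin (κ * ((x : ℂ) - a)))
      (Complex.cos (κ * (x - a)) * κ) x := fun x =>
    (Complex.hasDerivAt_sin _).comp x (hlin x)
  have hcos : ∀ x : ℝ, HasDerivAt (fun x : ℝ => Complex.cos (κ * ((x : ℂ) - a)))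
      (-Complex.sin (κ * (x - a)) * κ) x := fun x =>
    (Complex.hasDerivAt_cos _).comp x (hlin x)
  -- The two conserved quantities are the vector `(κ u, v)` rotated by the angle `κ (x - a)`; at `a`
  -- they equal `v a` and `0`, and rotating back gives `κ u`.
  have hA := constOn_of_hasDerivAt_zero (a := a) (b := b)
    (w := fun x : ℝ => κ * u x * Complex.sin (κ * (x - a)) + v x * Complex.cos (κ * (x - a)))
    fun x hx => by
      have := (((hu x hx).const_mul κ).mul (hsin x)).add ((hv x hx).mul (hcos x))
      refine this.congr_deriv ?_
      ring
  have hB := constOn_of_hasDerivAt_zero (a := a) (b := b)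
    (w := fun x : ℝ => κ * u x * Complex.cos (κ * (x - a)) - v x * Complex.sin (κ * (x - a)))
    fun x hx => by
      have := (((hu x hx).const_mul κ).mul (hcos x)).sub ((hv x hx).mul (hsin x))
      refine this.congr_deriv ?_
      ring
  intro x hx
  have hA' := hA x hx
  have hB' := hB x hx
  simp only [ha, sub_self, mul_zero, Complex.cos_zero, Complex.sin_zero, mul_one, zero_add]
    at hA' hB'
  have hsq := Complex.sin_sq_add_cos_sq (κ * (x - a))
  linear_combination Complex.sin (κ * (x - a)) * hA' + Complex.cos (κ * (x - a)) * hB' -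
    κ * u x * hsq

theorem eqOn_Icc_of_ae_eq {a b : ℝ} (hab : a < b) {u v : ℝ → ℂ} (hu : ContinuousOn u (Icc a b))
    (hv : ContinuousOn v (Icc a b)) (h : u =ᵐ[volume.restrict (Ioo a b)] v) :
    EqOn u v (Icc a b) := by
  have h1 : EqOn u v (Ioo a b) :=
    Measure.eqOn_open_of_ae_eq h isOpen_Ioo (hu.mono Ioo_subset_Icc_self)
      (hv.mono Ioo_subset_Icc_self)
  exact h1.of_subset_closure hu hv Ioo_subset_Icc_self (closure_Ioo hab.ne).symm.subset

theorem intervalIntegral_congr_ae_Ioo {a b x : ℝ} (hx : x ∈ Icc a b) {f g : ℝ → ℂ}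
    (h : f =ᵐ[volume.restrict (Ioo a b)] g) : ∫ y in a..x, f y = ∫ y in a..x, g y := by
  rw [← setIntegral_Ioo_eq_intervalIntegral hx.1, ← setIntegral_Ioo_eq_intervalIntegral hx.1]
  exact integral_congr_ae (ae_restrict_of_ae_restrict_of_subset (Ioo_subset_Ioo_right hx.2) h)

theorem exists_continuous_eqOn_Icc {a b : ℝ} (hab : a ≤ b) {u : ℝ → ℂ}
    (hu : ContinuousOn u (Icc a b)) : ∃ w : ℝ → ℂ, Continuous w ∧ EqOn w u (Icc a b) :=
  ⟨IccExtend hab ((Icc a b).domRestrict u),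
    (continuousOn_iff_continuous_domRestrict.1 hu).Icc_extend',
    fun _ hx => IccExtend_of_mem hab _ hx⟩

/-- Elements of the Dirichlet domain satisfying the eigenvalue equation weakly satisfy it
classically. -/
theorem exists_classical_solution {a b : ℝ} (hab : a < b) {f : L2 a b} {μ : ℂ}
    (hf : (f, μ • f) ∈ dirichletGraph a b) :
    ∃ u v : ℝ → ℂ, u =ᵐ[volume.restrict (Ioo a b)] f ∧
      (∀ x ∈ Icc a b, HasDerivAt u (v x) x) ∧
      (∀ x ∈ Icc a b, HasDerivAt v (-(2 * μ) * u x) x) ∧ u a = 0 ∧ u b = 0 := by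
  obtain ⟨f₁, f₂, h₁, h₂, ⟨u₀, hu₀, hu₀f, hu₀a, hu₀b⟩, hμ⟩ := hf
  simp only at h₁ hu₀f hμ
  have hf₂ : f₂ = (-(2 * μ)) • f := by
    have : f₂ = (-2 : ℂ) • (μ • f) := by
      rw [hμ, smul_smul]
      norm_num
    rw [this, smul_smul]
    ring_nf
  obtain ⟨C₁, hC₁⟩ := h₂.exists_ae_eq hab
  obtain ⟨C, hC⟩ := h₁.exists_ae_eq hab
  set v₀ : ℝ → ℂ := fun x => C₁ + ∫ y in a..x, f₂ y with hv₀
  have hv₀c : ContinuousOn v₀ (Icc a b) := by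
    refine continuousOn_const.add ?_
    have := intervalIntegral.continuousOn_primitive_interval' (f₂.intervalIntegrable hab.le)
      left_mem_uIcc
    rwa [uIcc_of_le hab.le] at this
  -- Continuous extensions to the line give primitives that are differentiable from both sides also
  -- at `a` and `b`.
  obtain ⟨U, hUc, hU⟩ := exists_continuous_eqOn_Icc hab.le hu₀
  obtain ⟨V, hVc, hV⟩ := exists_continuous_eqOn_Icc hab.le hv₀c
  have ae_of_eqOn : ∀ {p q : ℝ → ℂ}, EqOn p q (Icc a b) → p =ᵐ[volume.restrict (Ioo a b)] q := by
    intro p q h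
    filter_upwards [ae_restrict_mem measurableSet_Ioo] with x hx
    exact h (Ioo_subset_Icc_self hx)
  have hVf : V =ᵐ[volume.restrict (Ioo a b)] f₁ := (ae_of_eqOn hV).trans hC₁.symm
  have hUf : U =ᵐ[volume.restrict (Ioo a b)] f := (ae_of_eqOn hU).trans hu₀f
  set u : ℝ → ℂ := fun x => C + ∫ y in a..x, V y with hu
  set v : ℝ → ℂ := fun x => C₁ + ∫ y in a..x, -(2 * μ) * U y with hv
  have hW : Continuous fun y => -(2 * μ) * U y := hUc.const_mul _
  have hud : ∀ x, HasDerivAt u (V x) x := fun x =>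
    (intervalIntegral.integral_hasDerivAt_right (hVc.intervalIntegrable _ _)
      (hVc.stronglyMeasurableAtFilter _ _) hVc.continuousAt).const_add C
  have hvd : ∀ x, HasDerivAt v (-(2 * μ) * U x) x := fun x =>
    (intervalIntegral.integral_hasDerivAt_right (hW.intervalIntegrable _ _)
      (hW.stronglyMeasurableAtFilter _ _) hW.continuousAt).const_add C₁
  have huf : u =ᵐ[volume.restrict (Ioo a b)] f := by
    refine EventuallyEq.trans (ae_of_eqOn fun x hx => ?_) hC.symm
    simp only [hu]
    rw [intervalIntegral_congr_ae_Ioo hx hVf]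
  have huU : EqOn u U (Icc a b) :=
    eqOn_Icc_of_ae_eq hab (fun x _ => (hud x).continuousAt.continuousWithinAt) hUc.continuousOn
      (huf.trans hUf.symm)
  have hvV : EqOn v V (Icc a b) := by
    intro x hx
    rw [hV hx]
    simp only [hv, hv₀]
    congr 1
    refine intervalIntegral_congr_ae_Ioo hx ?_
    rw [hf₂]
    filter_upwards [hUf, Lp.coeFn_smul (-(2 * μ)) f] with y hy1 hy2
    rw [hy2, hy1, Pi.smul_apply, smul_eq_mul]
  refine ⟨u, v, huf, fun x hx => ?_, fun x hx => ?_, ?_, ?_⟩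
  · rw [hvV hx]; exact hud x
  · rw [huU hx]; exact hvd x
  · rw [huU (left_mem_Icc.2 hab.le), hU (left_mem_Icc.2 hab.le), hu₀a]
  · rw [huU (right_mem_Icc.2 hab.le), hU (right_mem_Icc.2 hab.le), hu₀b]

/-! ### The explicit eigenfunctions -/

/-- The function `sin (k π (x - a) / (b - a))`. -/
noncomputable def sine (a b : ℝ) (k : ℕ) (x : ℝ) : ℝ :=
  Real.sin (k * Real.pi / (b - a) * (x - a))

theorem continuous_sine (a b : ℝ) (k : ℕ) : Continuous (sine a b k) := by
  unfold sine
  fun_prop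

/-- `sine a b k` as an element of `L²((a,b))`. -/
noncomputable def sineLp (a b : ℝ) (k : ℕ) : L2 a b :=
  contLp a b (fun x => (sine a b k x : ℂ)) (Complex.continuous_ofReal.comp (continuous_sine a b k))

theorem coeFn_sineLp (a b : ℝ) (k : ℕ) :
    sineLp a b k =ᵐ[volume.restrict (Ioo a b)] fun x => (sine a b k x : ℂ) :=
  coeFn_contLp a b _

theorem sine_left (a b : ℝ) (k : ℕ) : sine a b k a = 0 := by simp [sine]

theorem sine_right {a b : ℝ} (hab : a < b) (k : ℕ) : sine a b k b = 0 := by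
  have : b - a ≠ 0 := by linarith
  rw [sine, div_mul_cancel₀ _ this, Real.sin_nat_mul_pi]

/-- The `k`-th Dirichlet eigenvalue of `-Δ/2` on `(a,b)`. -/
noncomputable def dirichletEigenvalue (a b : ℝ) (k : ℕ) : ℝ :=
  (k * Real.pi / (b - a)) ^ 2 / 2

theorem hasDerivAt_sine (a b : ℝ) (k : ℕ) (x : ℝ) :
    HasDerivAt (sine a b k)
      (k * Real.pi / (b - a) * Real.cos (k * Real.pi / (b - a) * (x - a))) x := by
  have h := (((hasDerivAt_id x).sub_const a).const_mul (k * Real.pi / (b - a))).sin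
  refine h.congr_deriv ?_
  simp only [id]
  ring

theorem hasDerivAt_deriv_sine (a b : ℝ) (k : ℕ) (x : ℝ) :
    HasDerivAt (fun x => k * Real.pi / (b - a) * Real.cos (k * Real.pi / (b - a) * (x - a)))
      (-(2 * dirichletEigenvalue a b k) * sine a b k x) x := by
  have h := ((((hasDerivAt_id x).sub_const a).const_mul (k * Real.pi / (b - a))).cos).const_mul
    (k * Real.pi / (b - a))
  refine h.congr_deriv ?_
  simp only [id, sine, dirichletEigenvalue]
  ring

theorem sineLp_mem_dirichletGraph {a b : ℝ} (hab : a < b) (k : ℕ) :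
    (sineLp a b k, (dirichletEigenvalue a b k : ℂ) • sineLp a b k) ∈ dirichletGraph a b := by
  set e : ℝ := dirichletEigenvalue a b k with he
  have hc1 : Continuous fun x : ℝ =>
      ((k * Real.pi / (b - a) * Real.cos (k * Real.pi / (b - a) * (x - a)) : ℝ) : ℂ) := by
    fun_prop
  have hc2 : Continuous fun x : ℝ => ((-(2 * e) * sine a b k x : ℝ) : ℂ) :=
    Complex.continuous_ofReal.comp (continuous_const.mul (continuous_sine a b k))
  refine ⟨contLp a b _ hc1, contLp a b _ hc2,
    hasWeakDeriv_contLp (Complex.continuous_ofReal.comp (continuous_sine a b k)) hc1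
      fun x => (hasDerivAt_sine a b k x).ofReal_comp,
    hasWeakDeriv_contLp hc1 hc2 fun x => (hasDerivAt_deriv_sine a b k x).ofReal_comp,
    ⟨fun x => (sine a b k x : ℂ),
      (Complex.continuous_ofReal.comp (continuous_sine a b k)).continuousOn,
      (coeFn_sineLp a b k).symm, by simp [sine_left], by simp [sine_right hab]⟩, ?_⟩
  refine Lp.ext ?_
  filter_upwards [Lp.coeFn_smul (e : ℂ) (sineLp a b k), coeFn_sineLp a b k,
    Lp.coeFn_smul (-(1 / 2) : ℂ) (contLp a b _ hc2), coeFn_contLp a b hc2] with x h1 h2 h3 h4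
  rw [h1, h3, Pi.smul_apply, Pi.smul_apply, h2, h4]
  push_cast
  simp only [smul_eq_mul]
  ring

theorem eq_smul_sineLp {a b : ℝ} (hab : a < b) {f : L2 a b} {μ : ℝ}
    (hf : (f, (μ : ℂ) • f) ∈ dirichletGraph a b) (hf0 : f ≠ 0) :
    ∃ k : ℕ, 1 ≤ k ∧ μ = dirichletEigenvalue a b k ∧ ∃ c : ℂ, f = c • sineLp a b k := by
  obtain ⟨u, v, huf, hu, hv, hua, hub⟩ := exists_classical_solution hab hf
  have hl : b - a ≠ 0 := by linarith
  have hlC : (b : ℂ) - a ≠ 0 := by exact_mod_cast hl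
  have hu0 : ¬ ∀ x ∈ Icc a b, u x = 0 := by
    intro h
    refine hf0 (Lp.ext ?_)
    filter_upwards [huf, ae_restrict_mem measurableSet_Ioo,
      Lp.coeFn_zero ℂ 2 (volume.restrict (Ioo a b))] with x h1 h2 h3
    rw [h3, ← h1, h x (Ioo_subset_Icc_self h2), Pi.zero_apply]
  -- A complex square root treats all signs of `μ` at once: the zeros of the complex sine are real,
  -- which rules out `μ < 0`. For `κ = 0` the solution is affine and so vanishes.
  obtain ⟨κ, hκ⟩ := IsAlgClosed.exists_pow_nat_eq (2 * (μ : ℂ)) (n := 2) (by norm_num)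
  rw [← hκ] at hv
  have hκ0 : κ ≠ 0 := by
    rintro rfl
    refine hu0 ?_
    have hvc := constOn_of_hasDerivAt_zero fun x hx => (hv x hx).congr_deriv (by simp)
    have huc := constOn_of_hasDerivAt_zero (a := a) (b := b)
      (w := fun x : ℝ => u x - v a * (x - a)) fun x hx => by
        have := (hu x hx).sub
          (((Complex.ofRealCLM.hasDerivAt (x := x)).sub_const (a : ℂ)).const_mul (v a))
        refine this.congr_deriv ?_
        rw [hvc x hx]
        simp
    have hva : v a = 0 := by
      have := huc b (right_mem_Icc.2 hab.le)
      simpa [hua, hub, hlC] using this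
    intro x hx
    simpa [hua, hva] using huc x hx
  have hsol := mul_eq_sin_of_hasDerivAt hu hv hua
  have hva : v a ≠ 0 := by
    intro h
    refine hu0 fun x hx => ?_
    have := hsol x hx
    rw [h, zero_mul] at this
    exact (mul_eq_zero.1 this).resolve_left hκ0
  have hsinb : Complex.sin (κ * (b - a)) = 0 := by
    have := hsol b (right_mem_Icc.2 hab.le)
    rw [hub, mul_zero] at this
    exact (mul_eq_zero.1 this.symm).resolve_left hva
  obtain ⟨n, hn⟩ := Complex.sin_eq_zero_iff.1 hsinb
  have hκn : κ = n * Real.pi / (b - a) := by rw [eq_div_iff hlC, hn]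
  have hn0 : n ≠ 0 := by
    rintro rfl
    exact hκ0 (by simpa using hκn)
  -- Only `|n|` matters; the sign goes into the scalar `s`.
  obtain ⟨k, hk⟩ := n.eq_nat_or_neg
  refine ⟨k, by omega, ?_, ?_⟩
  · have h1 : (k : ℝ) ^ 2 = (n : ℝ) ^ 2 := by
      rcases hk with rfl | rfl <;> simp
    have h2 : (2 * μ : ℝ) = (n * Real.pi / (b - a)) ^ 2 := by
      rw [hκn] at hκ
      exact_mod_cast hκ.symm
    rw [dirichletEigenvalue, div_pow, mul_pow, h1, ← mul_pow, ← div_pow, ← h2]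
    ring
  · obtain ⟨s, hs⟩ : ∃ s : ℂ, ∀ x : ℝ,
        Complex.sin (κ * (x - a)) = s * (sine a b k x : ℂ) := by
      rcases hk with rfl | rfl
      · refine ⟨1, fun x => ?_⟩
        rw [hκn, sine]
        push_cast
        ring_nf
      · refine ⟨-1, fun x => ?_⟩
        rw [hκn, sine]
        push_cast
        rw [neg_one_mul, ← Complex.sin_neg]
        ring_nf
    refine ⟨v a * s / κ, Lp.ext ?_⟩
    filter_upwards [huf, ae_restrict_mem measurableSet_Ioo, coeFn_sineLp a b k,
      Lp.coeFn_smul (v a * s / κ) (sineLp a b k)] with x h1 h2 h3 h4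
    rw [h4, Pi.smul_apply, h3, ← h1, smul_eq_mul]
    have := hsol x (Ioo_subset_Icc_self h2)
    rw [hs] at this
    field_simp
    linear_combination this

theorem sineLp_ne_zero {a b : ℝ} (hab : a < b) {k : ℕ} (hk : 1 ≤ k) : sineLp a b k ≠ 0 := by
  intro h
  have h1 : (fun x => (sine a b k x : ℂ)) =ᵐ[volume.restrict (Ioo a b)] fun _ => 0 := by
    have h2 := coeFn_sineLp a b k
    rw [h] at h2
    exact h2.symm.trans (Lp.coeFn_zero ℂ 2 _)
  have h3 := eqOn_Icc_of_ae_eq hab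
    (Complex.continuous_ofReal.comp (continuous_sine a b k)).continuousOn continuousOn_const h1
  have hk' : (1 : ℝ) ≤ k := by exact_mod_cast hk
  have hl : 0 < b - a := by linarith
  -- The first maximum of the sine, where it equals 1.
  have h4 := h3 (x := a + (b - a) / (2 * k)) ⟨by
    have : 0 ≤ (b - a) / (2 * k) := by positivity
    linarith, by
    have : (b - a) / (2 * k) ≤ b - a := div_le_self hl.le (by linarith)
    linarith⟩
  have h5 : k * Real.pi / (b - a) * (a + (b - a) / (2 * k) - a) = Real.pi / 2 := by
    field_simp
    ring
  simp only [sine, h5, Function.comp] at h4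
  simp at h4

theorem dirichletEigenvalue_injective {a b : ℝ} (hab : a < b) :
    Function.Injective (dirichletEigenvalue a b) := by
  intro k k' h
  have hl : 0 < b - a := by linarith
  have hp := Real.pi_pos
  have h1 : (k * Real.pi / (b - a)) ^ 2 = (k' * Real.pi / (b - a)) ^ 2 := by
    simp only [dirichletEigenvalue] at h
    linarith
  have h2 : k * Real.pi / (b - a) = k' * Real.pi / (b - a) :=
    (pow_left_inj₀ (by positivity) (by positivity) two_ne_zero).1 h1
  have h3 : (k : ℝ) = k' := by
    field_simp at h2
    exact h2
  exact_mod_cast h3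

/-- Lagrange's identity: the Wronskian vanishes at both ends, and its derivative is the product of
the two sines times twice the difference of the eigenvalues, which is nonzero. -/
theorem inner_sineLp {a b : ℝ} (hab : a < b) {k k' : ℕ} (h : k ≠ k') :
    inner ℂ (sineLp a b k) (sineLp a b k') = 0 := by
  rw [L2.inner_def]
  have h1 : ∫ x in Ioo a b, inner ℂ (sineLp a b k x) (sineLp a b k' x) =
      ∫ x in Ioo a b, ((sine a b k x * sine a b k' x : ℝ) : ℂ) := by
    refine integral_congr_ae ?_
    filter_upwards [coeFn_sineLp a b k, coeFn_sineLp a b k'] with x h1 h2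
    rw [h1, h2]
    simp [mul_comm]
  rw [h1, setIntegral_Ioo_eq_intervalIntegral hab.le, intervalIntegral.integral_ofReal]
  have hc : Continuous fun x => sine a b k x * sine a b k' x :=
    (continuous_sine a b k).mul (continuous_sine a b k')
  have h2 := intervalIntegral.integral_eq_sub_of_hasDerivAt (a := a) (b := b)
    (f := fun x => sine a b k x *
        (k' * Real.pi / (b - a) * Real.cos (k' * Real.pi / (b - a) * (x - a))) -
      k * Real.pi / (b - a) * Real.cos (k * Real.pi / (b - a) * (x - a)) * sine a b k' x)
    (f' := fun x => 2 * (dirichletEigenvalue a b k - dirichletEigenvalue a b k') *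
      (sine a b k x * sine a b k' x))
    (fun x _ => (((hasDerivAt_sine a b k x).mul (hasDerivAt_deriv_sine a b k' x)).sub
      ((hasDerivAt_deriv_sine a b k x).mul (hasDerivAt_sine a b k' x))).congr_deriv (by ring))
    ((hc.const_mul _).intervalIntegrable _ _)
  rw [intervalIntegral.integral_const_mul] at h2
  simp only [sine_left, sine_right hab, zero_mul, mul_zero, sub_zero] at h2
  have h3 : dirichletEigenvalue a b k - dirichletEigenvalue a b k' ≠ 0 :=
    sub_ne_zero.2 fun he => h (dirichletEigenvalue_injective hab he)
  have h4 := (mul_eq_zero.1 h2).resolve_left (mul_ne_zero two_ne_zero h3)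
  rw [h4, Complex.ofReal_zero]

/-! ### The counting function of the Hamiltonian -/

/-- Each component of an eigenvector of the sum is zero or an eigenvector for the same `μ`. So the
vectors `s j k`, extended by zero, span the eigenvectors below `E`, and they are independent because
they are nonzero and orthogonal. -/
theorem eigenvalueCount_directSumOp {ι : Type} [Fintype ι] {H : ι → Type}
    [∀ j, NormedAddCommGroup (H j)] [∀ j, InnerProductSpace ℂ (H j)]
    (T : ∀ j, H j →ₗ.[ℂ] H j) (E : ℝ) (N : ι → ℕ) (s : ∀ j, Fin (N j) → H j)
    (hs0 : ∀ j k, s j k ≠ 0) (hs : ∀ j k k', k ≠ k' → inner ℂ (s j k) (s j k') = 0)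
    (hsT : ∀ j k, ∃ μ : ℝ, μ < E ∧ (s j k, (μ : ℂ) • s j k) ∈ (T j).graph)
    (hT : ∀ j (μ : ℝ) (f : H j), μ < E → (f, (μ : ℂ) • f) ∈ (T j).graph →
      f ∈ Submodule.span ℂ (range (s j))) :
    eigenvalueCount (directSumOp T) E = ∑ j, N j := by
  classical
  set e : (Σ j, Fin (N j)) → PiLp 2 H := fun p => WithLp.toLp 2 (Pi.single p.1 (s p.1 p.2)) with he
  have hind : LinearIndependent ℂ e := by
    refine linearIndependent_of_ne_zero_of_inner_eq_zero ?_ ?_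
    · rintro ⟨j, k⟩ h
      have := congrArg (fun f : PiLp 2 H => f j) h
      simp only [he] at this
      exact hs0 j k (by simpa using this)
    · rintro ⟨j, k⟩ ⟨j', k'⟩ hne
      simp only [he, PiLp.inner_apply]
      refine Finset.sum_eq_zero fun i _ => ?_
      by_cases hi : i = j
      · subst hi
        by_cases hj : i = j'
        · subst hj
          simpa using hs i k k' fun h => hne (by rw [h])
        · simp [Pi.single_eq_of_ne hj]
      · simp [Pi.single_eq_of_ne hi]
  have hspan : Submodule.span ℂ {f : PiLp 2 H | ∃ μ : ℝ, μ < E ∧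
      ∃ hf : f ∈ (directSumOp T).domain, directSumOp T ⟨f, hf⟩ = (μ : ℂ) • f} =
      Submodule.span ℂ (range e) := by
    refine le_antisymm (Submodule.span_le.2 ?_) (Submodule.span_le.2 ?_)
    · rintro f ⟨μ, hμ, hf, hTf⟩
      have hj : ∀ j, f j ∈ Submodule.span ℂ (range (s j)) := by
        intro j
        refine hT j μ (f j) hμ ?_
        rw [LinearPMap.mem_graph_iff]
        exact ⟨⟨f j, hf j⟩, rfl, congrArg (fun g : PiLp 2 H => g j) hTf⟩
      have hf' : f = ∑ j, WithLp.toLp 2 (Pi.single j (f j)) := by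
        ext i
        simp [Finset.sum_apply]
      rw [hf']
      refine Submodule.sum_mem _ fun j _ => ?_
      let ι : H j →ₗ[ℂ] PiLp 2 H :=
        (WithLp.linearEquiv 2 ℂ (∀ j, H j)).symm.toLinearMap ∘ₗ LinearMap.single ℂ H j
      have h1 : ι (f j) ∈ (Submodule.span ℂ (range (s j))).map ι :=
        Submodule.mem_map_of_mem (hj j)
      rw [Submodule.map_span] at h1
      refine Submodule.span_mono ?_ h1
      rintro _ ⟨_, ⟨k, rfl⟩, rfl⟩
      exact ⟨⟨j, k⟩, rfl⟩
    · rintro _ ⟨⟨j, k⟩, rfl⟩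
      refine Submodule.subset_span ?_
      obtain ⟨μ, hμ, hg⟩ := hsT j k
      have hg' : ∀ i, ((e ⟨j, k⟩ : PiLp 2 H) i, (μ : ℂ) • (e ⟨j, k⟩ : PiLp 2 H) i) ∈
          (T i).graph := by
        intro i
        by_cases hi : i = j
        · subst hi
          simpa [he] using hg
        · simp [he, Pi.single_eq_of_ne hi]
      have hd : e ⟨j, k⟩ ∈ (directSumOp T).domain := fun i =>
        LinearPMap.mem_domain_of_mem_graph (hg' i)
      refine ⟨μ, hμ, hd, ?_⟩
      ext i
      obtain ⟨y, hy1, hy2⟩ := (LinearPMap.mem_graph_iff _).1 (hg' i)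
      have : y = ⟨(e ⟨j, k⟩ : PiLp 2 H) i, hd i⟩ := Subtype.ext hy1
      rw [this] at hy2
      exact hy2
  rw [eigenvalueCount, hspan, finrank_span_eq_card hind, Fintype.card_sigma]
  simp

/-- Taking square roots gives `kπ < (b - a) √2 √E`; the factor `1/2` in the operator is what puts
`√2` into `cLS`. -/
theorem dirichletEigenvalue_lt_iff {a b : ℝ} (hab : a < b) {E : ℝ} (hE : 0 < E) (k : ℕ) :
    dirichletEigenvalue a b k < E ↔ k * (cLS / √E) < b - a := by
  have hl : 0 < b - a := by linarith
  have hp := Real.pi_pos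
  have hsE : 0 < √E := Real.sqrt_pos.2 hE
  have h2 : 0 < √(2 : ℝ) := by positivity
  have h3 : k * (cLS / √E) < b - a ↔ k * Real.pi < (b - a) * (√2 * √E) := by
    rw [cLS, div_div, ← mul_div_assoc, div_lt_iff₀ (by positivity)]
  rw [h3, ← pow_lt_pow_iff_left₀ (a := k * Real.pi) (by positivity) (by positivity) two_ne_zero,
    dirichletEigenvalue, div_pow, div_div, div_lt_iff₀ (by positivity), mul_pow (b - a), mul_pow √2,
    Real.sq_sqrt (by norm_num), Real.sq_sqrt hE.le]
  constructor <;> intro h <;> linarith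

/-- This is where the spectral problem becomes one about spacings. No ordering of the nodes is
required: an interval with reversed or equal ends has trivial `L²` and contributes zero to both
sides. -/
theorem eigenvalueCount_hamiltonian (L : ℝ) {m : ℕ} (y : Fin m → ℝ) {E : ℝ} (hE : 0 < E) :
    eigenvalueCount (hamiltonian L y) E = ∑ j, multiplesBelow (cLS / √E) (spacing L y j) := by
  have hsE : 0 < √E := Real.sqrt_pos.2 hE
  have ha : 0 < cLS / √E := by
    have := Real.pi_pos
    unfold cLS
    positivity
  have hab : ∀ (j : Fin (m + 1)) {k : ℕ}, 1 ≤ k →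
      k ≤ multiplesBelow (cLS / √E) (spacing L y j) →
      nodes L y j.castSucc < nodes L y j.succ := by
    intro j k hk h
    have h1 := (le_multiplesBelow_iff ha hk).1 h
    have h2 : 0 ≤ k * (cLS / √E) := by positivity
    rw [spacing] at h1
    linarith
  have hk : ∀ (j : Fin (m + 1)) (k : Fin (multiplesBelow (cLS / √E) (spacing L y j))),
      nodes L y j.castSucc < nodes L y j.succ := fun j k =>
    hab j (k := k + 1) (by omega) (by have := k.2; omega)
  rw [hamiltonian]
  -- The shift by one is there because `Fin` starts at 0, while the sine with `k = 0` vanishes.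
  refine eigenvalueCount_directSumOp _ E _ (fun j k => sineLp _ _ (k + 1)) ?_ ?_ ?_ ?_
  · exact fun j k => sineLp_ne_zero (hk j k) (by omega)
  · exact fun j k k' hne => inner_sineLp (hk j k) fun h => hne (Fin.ext (by omega))
  · intro j k
    refine ⟨_, ?_, by
      rw [dirichletOp_graph]
      exact sineLp_mem_dirichletGraph (hk j k) _⟩
    rw [dirichletEigenvalue_lt_iff (hk j k) hE]
    exact (le_multiplesBelow_iff ha (l := spacing L y j) (by omega)).1 (by have := k.2; omega)
  · intro j μ f hμ hf
    rw [dirichletOp_graph] at hf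
    by_cases hf0 : f = 0
    · rw [hf0]
      exact Submodule.zero_mem _
    rcases le_or_gt (nodes L y j.succ) (nodes L y j.castSucc) with h | h
    · have hae : ∀ p : ℝ → Prop,
          ∀ᵐ x ∂volume.restrict (Ioo (nodes L y j.castSucc) (nodes L y j.succ)), p x := by
        rw [Ioo_eq_empty (not_lt.2 h)]
        simp
      exact absurd (Lp.ext (hae _)) hf0
    obtain ⟨k, hk1, rfl, c, rfl⟩ := eq_smul_sineLp h hf hf0
    refine Submodule.smul_mem _ c (Submodule.subset_span ?_)
    have hkN : k ≤ multiplesBelow (cLS / √E) (spacing L y j) :=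
      (le_multiplesBelow_iff ha hk1).2 ((dirichletEigenvalue_lt_iff h hE k).1 hμ)
    refine ⟨⟨k - 1, by omega⟩, ?_⟩
    simp only
    congr 1
    omega

/-! ### The thermodynamic limit -/

theorem cLS_pos : 0 < cLS := by
  have := Real.pi_pos
  unfold cLS
  positivity

theorem IsTypical.tendsto_finiteIDS {u : ∀ m : ℕ, Fin m → ℝ} (hu : IsTypical u) {α : Type*}
    {l : Filter α} {m : α → ℕ} {L : α → ℝ} (hL : Tendsto L l atTop) {lam : ℝ} (hlam : 0 < lam)
    (hmL : Tendsto (fun x => ((m x : ℝ) + 1) / L x) l (𝓝 lam)) {E : ℝ} (hE : 0 < E) :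
    Tendsto (fun x => finiteIDS (L x) (fun k => L x * u (m x) k) E) l (𝓝 (limitIDS lam E)) := by
  have h := hu.tendsto_sum_multiplesBelow hL hlam hmL
    (a := cLS / √E) (div_pos cLS_pos (Real.sqrt_pos.2 hE))
  have e : lam * (cLS / √E) = cLS * lam / √E := by ring
  rw [e] at h
  refine h.congr fun x => ?_
  rw [finiteIDS, eigenvalueCount_hamiltonian _ _ hE]
  push_cast
  rfl

/-- Rescaling the box `[-L/2, L/2]` to `[-1/2, 1/2]`. -/
theorem IsUniformImpurities.rescale {Ω : Type*} [MeasurableSpace Ω] {P : Measure Ω} {L : ℝ}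
    (hL : 0 < L) {m : ℕ} {Y : Fin m → Ω → ℝ} (hY : IsUniformImpurities P L Y) :
    IsUniformImpurities P 1 fun k ω => L⁻¹ * Y k ω where
  measurable k := (hY.measurable k).const_mul _
  indep := hY.indep.comp (fun _ x => L⁻¹ * x) fun _ => measurable_const_mul _
  uniform k := by
    have hms : ∀ L, MeasurableSet (box L) := fun L => measurableSet_Icc
    have h1 : P.map (fun ω => L⁻¹ * Y k ω) = (P.map (Y k)).map (fun x => L⁻¹ * x) :=
      (Measure.map_map (measurable_const_mul _) (hY.measurable k)).symm
    rw [pdf.IsUniform, h1, show P.map (Y k) = _ from hY.uniform k]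
    ext s hs
    have hpre : box L ∩ (fun x => L⁻¹ * x) ⁻¹' s = (fun x => L⁻¹ * x) ⁻¹' (box 1 ∩ s) := by
      ext x
      have : x ∈ box L ↔ L⁻¹ * x ∈ box 1 := by
        simp only [box, mem_Icc, ← div_eq_inv_mul, le_div_iff₀ hL, div_le_iff₀ hL]
        constructor <;> rintro ⟨h1, h2⟩ <;> constructor <;> linarith
      simp only [mem_inter_iff, mem_preimage, this]
    have hL' : ENNReal.ofReal L ≠ 0 := by simpa using hL
    rw [Measure.map_apply (measurable_const_mul _) hs, cond_apply (hms _), cond_apply (hms _), hpre,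
      Real.volume_preimage_mul_left (inv_ne_zero hL.ne'), inv_inv, abs_of_pos hL, volume_box_one,
      box, Real.volume_Icc, show L / 2 - -(L / 2) = L by ring, ← mul_assoc,
      ENNReal.inv_mul_cancel hL' ENNReal.ofReal_ne_top, inv_one]

theorem ae_tendsto_finiteIDS_nat {Ω : Type*} [MeasurableSpace Ω] {P : Measure Ω}
    [IsProbabilityMeasure P] {lam : ℝ} (hlam : 0 < lam) {L : ℕ → ℝ} (hL : ∀ m, 0 < L m)
    (hmL : Tendsto (fun m : ℕ => ((m : ℝ) + 1) / L m) atTop (𝓝 lam)) {Y : ∀ m : ℕ, Fin m → Ω → ℝ}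
    (hY : ∀ m, IsUniformImpurities P (L m) (Y m)) :
    ∀ᵐ ω ∂P, ∀ E : ℝ, 0 < E →
      Tendsto (fun m : ℕ => finiteIDS (L m) (fun k => Y m k ω) E) atTop
        (𝓝 (limitIDS lam E)) := by
  have hLtop : Tendsto L atTop atTop := by
    have h1 : Tendsto (fun m : ℕ => (m : ℝ) + 1) atTop atTop :=
      tendsto_atTop_add_const_right _ _ tendsto_natCast_atTop_atTop
    refine ((hmL.inv₀ hlam.ne').pos_mul_atTop (inv_pos.2 hlam) h1).congr fun m => ?_
    have : (m : ℝ) + 1 ≠ 0 := by positivity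
    rw [inv_div, div_mul_cancel₀ _ this]
  filter_upwards [ae_isTypical fun m => (hY m).rescale (hL m)] with ω hω E hE
  refine (hω.tendsto_finiteIDS hLtop hlam hmL hE).congr fun m => ?_
  congr 1
  funext k
  exact mul_inv_cancel_left₀ (hL m).ne' _

/-- The uncountable parameter `L` does no harm: the exceptional set is that of the countably many
samples `U m`, and the passage to real `L` is deterministic. -/
theorem ae_tendsto_finiteIDS_real {Ω : Type*} [MeasurableSpace Ω] {P : Measure Ω}
    [IsProbabilityMeasure P] {lam : ℝ} (hlam : 0 < lam) {m : ℝ → ℕ}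
    (hmL : Tendsto (fun L : ℝ => ((m L : ℝ) + 1) / L) atTop (𝓝 lam)) {U : ∀ m : ℕ, Fin m → Ω → ℝ}
    (hU : ∀ m, IsUniformImpurities P 1 (U m)) :
    ∀ᵐ ω ∂P, ∀ E : ℝ, 0 < E →
      Tendsto (fun L : ℝ => finiteIDS L (fun k => L * U (m L) k ω) E) atTop
        (𝓝 (limitIDS lam E)) := by
  filter_upwards [ae_isTypical hU] with ω hω E hE
  exact hω.tendsto_finiteIDS tendsto_id hlam hmL hE

/-! ### The Lifshitz tail -/

theorem tendsto_cLS_mul_div_sqrt {lam : ℝ} (hlam : 0 < lam) :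
    Tendsto (fun E : ℝ => cLS * lam / √E) (𝓝[>] 0) atTop := by
  have h1 : Tendsto (fun E : ℝ => √E) (𝓝[>] 0) (𝓝[>] 0) := by
    refine tendsto_nhdsWithin_iff.2 ⟨?_, ?_⟩
    · have := (Real.continuous_sqrt.tendsto 0).mono_left (nhdsWithin_le_nhds (s := Ioi 0))
      simpa using this
    · filter_upwards [self_mem_nhdsWithin] with E hE
      exact Real.sqrt_pos.2 hE
  exact (tendsto_inv_nhdsGT_zero.comp h1).const_mul_atTop (mul_pos cLS_pos hlam)

theorem tendsto_exp_neg_cLS_mul_div_sqrt {lam : ℝ} (hlam : 0 < lam) :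
    Tendsto (fun E : ℝ => Real.exp (-(cLS * lam / √E))) (𝓝[>] 0) (𝓝 0) :=
  Real.tendsto_exp_neg_atTop_nhds_zero.comp (tendsto_cLS_mul_div_sqrt hlam)

theorem limitIDS_div_sub_one_isBigO {lam : ℝ} (hlam : 0 < lam) :
    (fun E : ℝ => limitIDS lam E / (lam * Real.exp (-(cLS * lam / √E))) - 1) =O[𝓝[>] 0]
      fun E : ℝ => Real.exp (-(cLS * lam / √E)) := by
  -- With `x` the exponential, the relative error is exactly `x / (1 - x)`, at most `2x` once `x <
  -- 1/2`.
  refine IsBigO.of_bound 2 ?_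
  filter_upwards [(tendsto_exp_neg_cLS_mul_div_sqrt hlam).eventually_lt_const
    (show (0 : ℝ) < 1 / 2 by norm_num)] with E hE
  rw [limitIDS]
  have hx0 := Real.exp_pos (-(cLS * lam / √E))
  generalize Real.exp (-(cLS * lam / √E)) = x at hE hx0
  have h1 : 0 < 1 - x := by linarith
  have h2 : lam * (x / (1 - x)) / (lam * x) - 1 = x / (1 - x) := by
    field_simp
    ring
  rw [h2, Real.norm_of_nonneg (by positivity), Real.norm_of_nonneg hx0.le, div_le_iff₀ h1]
  nlinarith

/-- The difference of the two sides is `log λ - log (1 - x)` with `x → 0`, hence bounded, while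
`cλ/√E` tends to infinity. -/
theorem log_limitIDS_isEquivalent {lam : ℝ} (hlam : 0 < lam) :
    (fun E : ℝ => Real.log (limitIDS lam E)) ~[𝓝[>] 0] fun E : ℝ => -(cLS * lam / √E) := by
  have hx := tendsto_exp_neg_cLS_mul_div_sqrt hlam
  have hlim : Tendsto (fun E : ℝ => Real.log lam - Real.log (1 - Real.exp (-(cLS * lam / √E))))
      (𝓝[>] 0) (𝓝 (Real.log lam - Real.log (1 - 0))) :=
    ((hx.const_sub 1).log (by norm_num)).const_sub _
  have ho : (fun _ : ℝ => (1 : ℝ)) =o[𝓝[>] 0] fun E : ℝ => -(cLS * lam / √E) := by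
    rw [isLittleO_one_left_iff]
    simp only [norm_neg]
    exact tendsto_norm_atTop_atTop.comp (tendsto_cLS_mul_div_sqrt hlam)
  refine ((hlim.isBigO_one ℝ).trans_isLittleO ho).congr' ?_ EventuallyEq.rfl
  filter_upwards [hx.eventually_lt_const one_pos] with E hE
  have hx0 := Real.exp_pos (-(cLS * lam / √E))
  have h1 : 0 < 1 - Real.exp (-(cLS * lam / √E)) := by linarith
  rw [Pi.sub_apply, limitIDS, Real.log_mul hlam.ne' (div_pos hx0 h1).ne',
    Real.log_div hx0.ne' h1.ne', Real.log_exp]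
  ring

end LuttingerSy

/-- Let `lam > 0`. With `n = m + 1` intervals, i.e. `m` impurities, the thermodynamic limit is
`n → ∞`, `L → ∞`, `n / L → lam`.

(1) Volumes `L m` along the number of impurities: the `m` impurities in `[-L m / 2, L m / 2]` are
independent and uniform for each `m`, with no assumption on the joint law for different `m`.

(2) Continuous volume `L → ∞` with an arbitrary number `m L` of impurities: those in
`[-L/2, L/2]` are `L` times independent uniform points of `[-1/2, 1/2]`, which depend on `L` only
through their number (again with no assumption on the joint law for different numbers).

In both cases the finite-volume integrated density of states converges almost surely, for all
energies simultaneously, to the nonrandom function `limitIDS lam`. (3), (4): Lifshitz tail. -/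
theorem mainTheorem3 {Ω : Type*} [MeasurableSpace Ω] (P : Measure Ω) [IsProbabilityMeasure P]
    (lam : ℝ) (hlam : 0 < lam) :
    (∀ (L : ℕ → ℝ) (_ : ∀ m, 0 < L m)
      (_ : Tendsto (fun m : ℕ => ((m : ℝ) + 1) / L m) atTop (𝓝 lam))
      (Y : ∀ m : ℕ, Fin m → Ω → ℝ)
      (_ : ∀ m, LuttingerSy.IsUniformImpurities P (L m) (Y m)),
      ∀ᵐ ω ∂P, ∀ E : ℝ, 0 < E →
        Tendsto (fun m : ℕ => LuttingerSy.finiteIDS (L m) (fun k => Y m k ω) E) atTop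
          (𝓝 (LuttingerSy.limitIDS lam E))) ∧
    (∀ (m : ℝ → ℕ)
      (_ : Tendsto (fun L : ℝ => ((m L : ℝ) + 1) / L) atTop (𝓝 lam))
      (U : ∀ m : ℕ, Fin m → Ω → ℝ)
      (_ : ∀ m, LuttingerSy.IsUniformImpurities P 1 (U m)),
      ∀ᵐ ω ∂P, ∀ E : ℝ, 0 < E →
        Tendsto (fun L : ℝ => LuttingerSy.finiteIDS L (fun k => L * U (m L) k ω) E) atTop
          (𝓝 (LuttingerSy.limitIDS lam E))) ∧
    (fun E : ℝ => LuttingerSy.limitIDS lam E /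
        (lam * Real.exp (-(LuttingerSy.cLS * lam / √E))) - 1) =O[𝓝[>] 0]
      (fun E : ℝ => Real.exp (-(LuttingerSy.cLS * lam / √E))) ∧
    (fun E : ℝ => Real.log (LuttingerSy.limitIDS lam E)) ~[𝓝[>] 0]
      (fun E : ℝ => -(LuttingerSy.cLS * lam / √E)) :=
  ⟨fun _ hL hmL _ hY => LuttingerSy.ae_tendsto_finiteIDS_nat hlam hL hmL hY,
    fun _ hmL _ hU => LuttingerSy.ae_tendsto_finiteIDS_real hlam hmL hU,
    LuttingerSy.limitIDS_div_sub_one_isBigO hlam, LuttingerSy.log_limitIDS_isEquivalent hlam⟩
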